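/- Let $X\subset\mathbb R$ be a finite set. Let $A$ be a Schrödinger operator with local interactions on $X$, that is, a self-adjoint operator on $L_2(\mathbb R)$ which extends the minimal operator $\varphi\mapsto-\varphi''$, $\varphi\in C_0^\infty(\mathbb R\setminus X)$, and which has the following property: if $u\in\mathfrak D(A)$, then $\chi u\in\mathfrak D(A)$ for every $\chi\in C_0^\infty(\mathbb R)$ with $\chi'\in C_0^\infty(\mathbb R\setminus X)$. We say that $A$ describes a $\delta'$-interaction on $X$ if there are real intensities $\beta_x$, $x\in X$ (zero being allowed), such that $\mathfrak D(A)$ consists of all functions $\psi\in W_2^2(\mathbb R\setminus X)$ with $$\psi'(x+0)-\psi'(x-0)=0,\qquad \psi(x+0)-\psi(x-0)=\beta_x\,\tfrac12\big[\psi'(x+0)+\psi'(x-0)\big]\qquad\text{for every }x\in X,$$ and $A\psi=-\psi''$ on $\mathbb R\setminus X$ for $\psi\in\mathfrak D(A)$. Then $A$ describes a $\delta'$-interaction on $X$ if and only if both of the following conditions hold: 1. every $\chi\in C_0^\infty(\mathbb R)$ with $\chi'\in C_0^\infty(\mathbb R\setminus X)$ belongs to $\mathfrak D(A)$; 2. for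 no $a\in\mathbb R$ does $A$ admit a representation as a direct sum $A=A_1\oplus A_2$ of self-adjoint operators $A_1$ on $L_2(-\infty,a)$ and $A_2$ on $L_2(a,+\infty)$, where $L_2(\mathbb R)=L_2(-\infty,a)\oplus L_2(a,+\infty)$. -/

import Mathlib

open MeasureTheory Filter Topology
open scoped ContDiff

namespace PointInteraction

/-- The Hilbert space `L₂(ℝ)` of complex-valued square-integrable functions. -/
abbrev L2R : Type := Lp ℂ 2 (volume : Measure ℝ)

/-- `φ ∈ C₀^∞(U)`: `φ` is smooth on `ℝ` and has compact support contained in `U`. -/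
structure IsTestFunction (U : Set ℝ) (φ : ℝ → ℂ) : Prop where
  smooth : ContDiff ℝ ∞ φ
  compact_support : HasCompactSupport φ
  support_subset : tsupport φ ⊆ U

/-- A cutting function for `X`: `χ ∈ C₀^∞(ℝ)` with `χ' ∈ C₀^∞(ℝ ∖ X)`. -/
def IsCutoff (X : Set ℝ) (χ : ℝ → ℂ) : Prop :=
  IsTestFunction Set.univ χ ∧ IsTestFunction Xᶜ (deriv χ)

/-- The (a.e. class of the) function `f` belongs to the domain of the operator `A`. -/
def MemDomain (A : L2R →ₗ.[ℂ] L2R) (f : ℝ → ℂ) : Prop :=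
  ∃ u : L2R, u ∈ A.domain ∧ ⇑u =ᵐ[volume] f

/-- `A` extends the minimal operator `φ ↦ -φ''` with domain `C₀^∞(ℝ ∖ X)`. -/
def ExtendsMinimal (X : Set ℝ) (A : L2R →ₗ.[ℂ] L2R) : Prop :=
  ∀ φ : ℝ → ℂ, IsTestFunction Xᶜ φ →
    ∃ u v : L2R, (u, v) ∈ A.graph ∧ ⇑u =ᵐ[volume] φ ∧
      ⇑v =ᵐ[volume] fun x => -deriv (deriv φ) x

/-- `A` is a one-dimensional Schrödinger operator with local interactions on `X`: a self-adjoint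
extension of the minimal operator on `ℝ ∖ X` whose domain is invariant under multiplication by
all cutting functions for `X`. -/
structure IsLocalInteraction (X : Set ℝ) (A : L2R →ₗ.[ℂ] L2R) : Prop where
  selfAdjoint : IsSelfAdjoint A
  extends_minimal : ExtendsMinimal X A
  isLocal : ∀ u : L2R, u ∈ A.domain → ∀ χ : ℝ → ℂ, IsCutoff X χ →
    MemDomain A (fun x => χ x * u x)

/-- `g` is the weak derivative of `u` on `ℝ ∖ X`. -/
def IsWeakDeriv (X : Set ℝ) (u g : L2R) : Prop :=
  ∀ φ : ℝ → ℂ, IsTestFunction Xᶜ φ → ∫ x, u x * deriv φ x = -∫ x, g x * φ x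

/-- `u ∈ W₂²(ℝ ∖ X)`, with first weak derivative `g` and second weak derivative `h`
(all three in `L₂(ℝ)`). -/
structure IsW22 (X : Set ℝ) (u g h : L2R) : Prop where
  weak_deriv : IsWeakDeriv X u g
  weak_deriv_two : IsWeakDeriv X g h

/-- `u(x₀ + 0) = c`, as an essential limit: it does not depend on the representative of `u`, and
it is the usual one-sided limit of a representative that is continuous on the right of `x₀`. -/
def HasRightValue (u : L2R) (x₀ : ℝ) (c : ℂ) : Prop :=
  Tendsto u (𝓝[>] x₀ ⊓ ae volume) (𝓝 c)

/-- `u(x₀ - 0) = c`, as an essential limit. -/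
def HasLeftValue (u : L2R) (x₀ : ℝ) (c : ℂ) : Prop :=
  Tendsto u (𝓝[<] x₀ ⊓ ae volume) (𝓝 c)

/-- The boundary conditions of a `δ'`-interaction of intensity `β` at `x₀`, for a function `u` with
derivative `g`: `u'(x₀+0) - u'(x₀-0) = 0` and
`u(x₀+0) - u(x₀-0) = β · (u'(x₀+0) + u'(x₀-0)) / 2`. -/
def DeltaPrimeCondition (β x₀ : ℝ) (u g : L2R) : Prop :=
  ∃ u₁ u₀ g₁ g₀ : ℂ,
    HasRightValue u x₀ u₁ ∧ HasLeftValue u x₀ u₀ ∧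
    HasRightValue g x₀ g₁ ∧ HasLeftValue g x₀ g₀ ∧
    g₁ - g₀ = 0 ∧ u₁ - u₀ = (β : ℂ) * ((g₁ + g₀) / 2)

/-- `A` describes a `δ'`-interaction on `X`: for some real intensities `β x`, `x ∈ X`, the operator
`A` is `u ↦ -u''` on the domain of all `u ∈ W₂²(ℝ ∖ X)` that satisfy the boundary conditions of a
`δ'`-interaction of intensity `β x` at every `x ∈ X`. -/
def IsDeltaPrimeInteraction (X : Set ℝ) (A : L2R →ₗ.[ℂ] L2R) : Prop :=
  ∃ β : ℝ → ℝ, ∀ u v : L2R, (u, v) ∈ A.graph ↔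
    ∃ g : L2R, IsW22 X u g (-v) ∧ ∀ x ∈ X, DeltaPrimeCondition (β x) x u g

/-- The restriction map `L₂(ℝ) → L₂(S)`. -/
noncomputable abbrev restrictL2 (S : Set ℝ) :
    L2R →L[ℂ] Lp ℂ 2 ((volume : Measure ℝ).restrict S) :=
  LpToLpRestrictCLM ℝ ℂ ℂ volume 2 S

/-- `A = A₁ ⊕ A₂` for some self-adjoint operators `A₁` on `L₂(-∞, a)` and `A₂` on `L₂(a, ∞)`, under
the identification `L₂(ℝ) = L₂(-∞, a) ⊕ L₂(a, ∞)`. -/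
def SplitsAt (A : L2R →ₗ.[ℂ] L2R) (a : ℝ) : Prop :=
  ∃ (A₁ : Lp ℂ 2 ((volume : Measure ℝ).restrict (Set.Iio a)) →ₗ.[ℂ]
        Lp ℂ 2 ((volume : Measure ℝ).restrict (Set.Iio a)))
    (A₂ : Lp ℂ 2 ((volume : Measure ℝ).restrict (Set.Ioi a)) →ₗ.[ℂ]
        Lp ℂ 2 ((volume : Measure ℝ).restrict (Set.Ioi a))),
    IsSelfAdjoint A₁ ∧ IsSelfAdjoint A₂ ∧
    ∀ u v : L2R, (u, v) ∈ A.graph ↔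
      (restrictL2 (Set.Iio a) u, restrictL2 (Set.Iio a) v) ∈ A₁.graph ∧
      (restrictL2 (Set.Ioi a) u, restrictL2 (Set.Ioi a) v) ∈ A₂.graph

end PointInteraction

/-!
Green's formula expresses `⟪A u, w⟫ - ⟪u, A w⟫` through the jumps at the points of `X` of the
Wronskian of `u` and `conj w`. As `A` is self-adjoint and cutting functions preserve its domain,
that Wronskian is continuous at every `x ∈ X` for all `u`, `w` in the domain. If all cutting
functions are in the domain, taking `w` equal to `1` near `x` shows that `u'` is continuous at `x`.
Were `u'(x) = 0` for all `u`, then cutting `u` at `x` would keep it in the domain and `A` would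
split at `x`. So, without splitting, some `w` has `w'(x) ≠ 0`, and continuity of the Wronskian reads
`[u] conj (w') = u' conj [w]`: the jump `[u]` is a multiple `β u'` with `β` independent of `u`, and
`β` is real by the case `u = w`. Self-adjointness leaves no room for further boundary conditions.

Conversely, a `δ'`-interaction does not split at `a`: otherwise its domain would contain a cutting
function equal to `1` near `a`, restricted to `(-∞, a)`, which violates the boundary condition at
`a`, or continuity if `a ∉ X`.
-/

open scoped ComplexConjugate

namespace PointInteraction

section Primitive

variable {f g : ℝ → ℂ}

/-- The primitive of `f` that takes the value `c` at the origin. -/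
noncomputable def primitive (c : ℂ) (f : ℝ → ℂ) (x : ℝ) : ℂ := c + ∫ t in (0 : ℝ)..x, f t

theorem intervalIntegrable_of_locallyIntegrable (hf : LocallyIntegrable f) (a b : ℝ) :
    IntervalIntegrable f volume a b :=
  (hf.integrableOn_isCompact isCompact_uIcc).intervalIntegrable

theorem primitive_eq_const_add (c : ℂ) (f : ℝ → ℂ) (x : ℝ) :
    primitive c f x = c + primitive 0 f x := by
  rw [primitive, primitive, zero_add]

theorem continuous_primitive (c : ℂ) (hf : LocallyIntegrable f) : Continuous (primitive c f) :=
  continuous_const.add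
    (intervalIntegral.continuous_primitive (intervalIntegrable_of_locallyIntegrable hf) 0)

theorem primitive_sub (c : ℂ) (hf : LocallyIntegrable f) (a b : ℝ) :
    primitive c f b - primitive c f a = ∫ t in a..b, f t := by
  rw [primitive, primitive, add_sub_add_left_eq_sub,
    intervalIntegral.integral_interval_sub_left (intervalIntegrable_of_locallyIntegrable hf _ _)
      (intervalIntegrable_of_locallyIntegrable hf _ _)]

theorem hasDerivAt_primitive (c : ℂ) (hf : Continuous f) (x : ℝ) :
    HasDerivAt (primitive c f) (f x) x :=
  (intervalIntegral.integral_hasDerivAt_right (hf.intervalIntegrable _ _)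
    (hf.stronglyMeasurableAtFilter _ _) hf.continuousAt).const_add c

theorem ae_hasDerivAt_primitive (c : ℂ) (hf : LocallyIntegrable f) :
    ∀ᵐ x, HasDerivAt (primitive c f) (f x) x := by
  filter_upwards [_root_.LocallyIntegrable.ae_hasDerivAt_integral hf] with x hx
  exact (hx 0).const_add c

theorem absolutelyContinuousOnInterval_primitive (c : ℂ) (hf : LocallyIntegrable f) (a b : ℝ) :
    AbsolutelyContinuousOnInterval (primitive c f) a b := by
  have hnorm : AbsolutelyContinuousOnInterval (fun x => ∫ t in a..x, ‖f t‖) a b :=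
    (intervalIntegrable_of_locallyIntegrable hf a b).norm
      |>.absolutelyContinuousOnInterval_intervalIntegral Set.left_mem_uIcc
  refine squeeze_zero (fun _ => Finset.sum_nonneg fun _ _ => dist_nonneg)
    (fun E => Finset.sum_le_sum fun i _ => ?_) hnorm
  rw [dist_comm, dist_comm (∫ t in a..(E.2 i).1, ‖f t‖), dist_eq_norm, Real.dist_eq,
    primitive_sub c hf, intervalIntegral.integral_interval_sub_left
      (intervalIntegrable_of_locallyIntegrable hf _ _).norm
      (intervalIntegrable_of_locallyIntegrable hf _ _).norm]
  exact intervalIntegral.norm_integral_le_abs_integral_norm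

theorem locallyIntegrable_primitive_mul (c : ℂ) (hf : LocallyIntegrable f)
    (hg : LocallyIntegrable g) : LocallyIntegrable fun x => primitive c f x * g x :=
  hg.continuous_smul (continuous_primitive c hf)

theorem primitive_mul_primitive (hf : LocallyIntegrable f) (hg : LocallyIntegrable g) (c d : ℂ)
    (x : ℝ) : primitive c f x * primitive d g x =
      primitive (c * d) (fun y => primitive c f y * g y + primitive d g y * f y) x := by
  set h : ℝ → ℂ := fun y => primitive c f y * g y + primitive d g y * f y with hh
  have hloc : LocallyIntegrable h :=
    (locallyIntegrable_primitive_mul c hf hg).add (locallyIntegrable_primitive_mul d hg hf)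
  have hac : AbsolutelyContinuousOnInterval
      (fun y => primitive c f y • primitive d g y - primitive (c * d) h y) 0 x :=
    ((absolutelyContinuousOnInterval_primitive c hf 0 x).fun_smul
      (absolutelyContinuousOnInterval_primitive d hg 0 x)).fun_sub
      (absolutelyContinuousOnInterval_primitive _ hloc 0 x)
  obtain ⟨C, hC⟩ := hac.const_of_ae_hasDerivAt_zero <| by
    filter_upwards [ae_hasDerivAt_primitive c hf, ae_hasDerivAt_primitive d hg,
      ae_hasDerivAt_primitive (c * d) hloc] with y hfy hgy hhy _
    exact ((hfy.mul hgy).sub hhy).congr_deriv (by simp only [hh]; ring)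
  have h0 := hC 0 Set.left_mem_uIcc
  simp only [primitive, intervalIntegral.integral_same, add_zero, smul_eq_mul, sub_self] at h0
  exact sub_eq_zero.mp ((hC x Set.right_mem_uIcc).trans h0.symm)

theorem tendsto_primitive_atTop (c : ℂ) (hf : Integrable f) :
    Tendsto (primitive c f) atTop (𝓝 (c + ∫ x in Set.Ioi 0, f x)) :=
  (intervalIntegral_tendsto_integral_Ioi 0 hf.integrableOn tendsto_id).const_add c

theorem tendsto_primitive_atBot (c : ℂ) (hf : Integrable f) :
    Tendsto (primitive c f) atBot (𝓝 (c - ∫ x in Set.Iic 0, f x)) := by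
  refine ((intervalIntegral_tendsto_integral_Iic 0 hf.integrableOn tendsto_id).const_sub c).congr
    fun x => ?_
  rw [id, intervalIntegral.integral_symm, sub_neg_eq_add, primitive]

theorem integral_eq_of_tendsto_primitive {c l l' : ℂ} (hf : Integrable f)
    (hl : Tendsto (primitive c f) atTop (𝓝 l)) (hl' : Tendsto (primitive c f) atBot (𝓝 l')) :
    ∫ x, f x = l - l' := by
  rw [tendsto_nhds_unique hl (tendsto_primitive_atTop c hf),
    tendsto_nhds_unique hl' (tendsto_primitive_atBot c hf),
    ← intervalIntegral.integral_Iic_add_Ioi hf.integrableOn hf.integrableOn (b := (0 : ℝ))]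
  ring

end Primitive

section TestFunction

variable {U V : Set ℝ} {φ ψ f : ℝ → ℂ}

namespace IsTestFunction

theorem mono (h : IsTestFunction U φ) (hUV : U ⊆ V) : IsTestFunction V φ :=
  ⟨h.smooth, h.compact_support, h.support_subset.trans hUV⟩

theorem deriv (h : IsTestFunction U φ) : IsTestFunction U (deriv φ) :=
  ⟨((contDiff_infty_iff_deriv (f := φ)).1 h.smooth).2, h.compact_support.deriv,
    tsupport_deriv_subset.trans h.support_subset⟩

theorem continuous (h : IsTestFunction U φ) : Continuous φ := h.smooth.continuous

theorem differentiable (h : IsTestFunction U φ) : Differentiable ℝ φ :=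
  h.smooth.differentiable (by simp)

theorem integrable (h : IsTestFunction U φ) : Integrable φ :=
  h.continuous.integrable_of_hasCompactSupport h.compact_support

theorem memLp (h : IsTestFunction U φ) : MemLp φ 2 volume :=
  h.continuous.memLp_of_hasCompactSupport h.compact_support

theorem integrable_mul (h : IsTestFunction U φ) (hf : LocallyIntegrable f) :
    Integrable fun x => f x * φ x := by
  simpa only [smul_eq_mul, mul_comm] using
    hf.integrable_smul_left_of_hasCompactSupport h.continuous h.compact_support

theorem sub_const_mul (hφ : IsTestFunction U φ) (hψ : IsTestFunction U ψ) (c : ℂ) :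
    IsTestFunction U fun x => φ x - c * ψ x := by
  refine ⟨hφ.smooth.sub (contDiff_const.mul hψ.smooth),
    hφ.compact_support.sub (hψ.compact_support.mul_left), ?_⟩
  refine (tsupport_sub φ _).trans (Set.union_subset hφ.support_subset ?_)
  exact (tsupport_mul_subset_right (f := fun _ => c) (g := ψ)).trans hψ.support_subset

theorem primitive_deriv (h : IsTestFunction U φ) :
    primitive (φ 0) (_root_.deriv φ) = φ := by
  ext x
  rw [primitive, intervalIntegral.integral_deriv_eq_sub (fun y _ => h.differentiable y)
    (h.deriv.continuous.intervalIntegrable _ _)]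
  ring

end IsTestFunction

theorem isTestFunction_ofReal {ψ : ℝ → ℝ} (hψ : ContDiff ℝ ∞ ψ) (hc : HasCompactSupport ψ)
    (hU : tsupport ψ ⊆ U) : IsTestFunction U fun x => (ψ x : ℂ) := by
  refine ⟨Complex.ofRealCLM.contDiff.comp hψ, hc.comp_left (g := Complex.ofReal) rfl,
    (closure_mono fun x hx => ?_).trans hU⟩
  exact fun h => hx (by simp [h])

theorem exists_isTestFunction_integral_eq_one (hU : IsOpen U) (hne : U.Nonempty) :
    ∃ η, IsTestFunction U η ∧ ∫ x, η x = 1 := by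
  obtain ⟨p, hp⟩ := hne
  obtain ⟨ε, hε, hball⟩ := Metric.isOpen_iff.1 hU p hp
  let b : ContDiffBump p := ⟨ε / 4, ε / 2, by positivity, by linarith⟩
  refine ⟨fun x => (b.normed volume x : ℂ), isTestFunction_ofReal b.contDiff_normed
    b.hasCompactSupport_normed ?_, ?_⟩
  · rw [b.tsupport_normed_eq]
    exact (Metric.closedBall_subset_ball (half_lt_self hε)).trans hball
  · rw [integral_complex_ofReal, b.integral_normed, Complex.ofReal_one]

theorem exists_isTestFunction_deriv_eq (hU : U.OrdConnected) (hψ : IsTestFunction U ψ)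
    (h0 : ∫ x, ψ x = 0) : ∃ φ, IsTestFunction U φ ∧ deriv φ = ψ := by
  rcases (tsupport ψ).eq_empty_or_nonempty with hempty | hne
  · obtain rfl : ψ = 0 := tsupport_eq_empty_iff.1 hempty
    exact ⟨0, hψ, deriv_const' 0⟩
  obtain ⟨m, hm⟩ := hψ.compact_support.isCompact.exists_isLeast hne
  obtain ⟨M, hM⟩ := hψ.compact_support.isCompact.exists_isGreatest hne
  have hψ0 : ∀ x ∉ Set.Icc m M, ψ x = 0 := fun x hx =>
    image_eq_zero_of_notMem_tsupport fun h => hx ⟨hm.2 h, hM.2 h⟩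
  set φ := primitive (∫ t in Set.Iic 0, ψ t) ψ
  have hφ : ∀ x, φ x = ∫ t in Set.Iic x, ψ t := fun x => by
    rw [sub_eq_iff_eq_add'.mp (intervalIntegral.integral_Iic_sub_Iic (a := 0) (b := x)
      hψ.integrable.integrableOn hψ.integrable.integrableOn)]
    rfl
  have hderiv : deriv φ = ψ := funext fun x => (hasDerivAt_primitive _ hψ.continuous x).deriv
  have hφ0 : ∀ x ∉ Set.Icc m M, φ x = 0 := by
    intro x hx
    rw [hφ]
    rcases lt_or_ge x m with hxm | hmx
    · exact setIntegral_eq_zero_of_forall_eq_zero fun t ht =>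
        hψ0 t fun h => (ht.trans_lt hxm).not_ge h.1
    · have hMx : M < x := lt_of_not_ge fun h => hx ⟨hmx, h⟩
      rw [setIntegral_eq_integral_of_forall_compl_eq_zero, h0]
      exact fun t ht => hψ0 t fun h => ht (h.2.trans hMx.le)
  have hsupp : tsupport φ ⊆ Set.Icc m M :=
    closure_minimal (Function.support_subset_iff'.2 hφ0) isClosed_Icc
  refine ⟨φ, ⟨?_, ?_, ?_⟩, hderiv⟩
  · rw [contDiff_infty_iff_deriv, hderiv]
    exact ⟨fun x => (hasDerivAt_primitive _ hψ.continuous x).differentiableAt, hψ.smooth⟩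
  · exact HasCompactSupport.of_support_subset_isCompact isCompact_Icc
      ((subset_tsupport _).trans hsupp)
  · exact hsupp.trans (hU.out (hψ.support_subset hm.1) (hψ.support_subset hM.1))

end TestFunction

section WeakDerivative

variable {U S : Set ℝ} {u v g k f w φ ψ : ℝ → ℂ}

/-- `g` is the weak derivative of `u` on the open set `U`. For square-integrable functions and
`U = Xᶜ` this unfolds to `IsWeakDeriv X`. -/
def HasWeakDerivOn (U : Set ℝ) (u g : ℝ → ℂ) : Prop :=
  ∀ φ : ℝ → ℂ, IsTestFunction U φ → ∫ x, u x * deriv φ x = -∫ x, g x * φ x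

theorem hasWeakDerivOn_primitive (U : Set ℝ) (c : ℂ) (hf : LocallyIntegrable f) :
    HasWeakDerivOn U (primitive c f) f := by
  intro φ hφ
  have hint₁ := hφ.deriv.integrable_mul (continuous_primitive c hf).locallyIntegrable
  have hint₂ := hφ.integrable_mul hf
  have hprim : ∀ x, primitive c f x * φ x =
      primitive (c * φ 0) (fun y => primitive c f y * deriv φ y + f y * φ y) x := fun x => by
    simpa only [hφ.primitive_deriv, mul_comm (φ _)] using
      primitive_mul_primitive hf hφ.deriv.continuous.locallyIntegrable c (φ 0) x
  have hzero : ∀ l ≤ cocompact ℝ, Tendsto (fun x => primitive c f x * φ x) l (𝓝 0) :=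
    fun l hl => tendsto_const_nhds.congr' <| by
      filter_upwards [hl hφ.compact_support.compl_mem_cocompact] with x hx
      rw [image_eq_zero_of_notMem_tsupport hx, mul_zero]
  simp only [hprim] at hzero
  have h0 := integral_eq_of_tendsto_primitive (hint₁.add hint₂) (hzero _ atTop_le_cocompact)
    (hzero _ atBot_le_cocompact)
  rw [integral_add' hint₁ hint₂, sub_zero] at h0
  exact eq_neg_of_add_eq_zero_left h0

theorem IsTestFunction.hasWeakDerivOn_deriv (hφ : IsTestFunction S φ) (U : Set ℝ) :
    HasWeakDerivOn U φ (_root_.deriv φ) := by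
  simpa only [hφ.primitive_deriv] using!
    hasWeakDerivOn_primitive U (φ 0) hφ.deriv.continuous.locallyIntegrable

theorem hasWeakDerivOn_zero (U : Set ℝ) : HasWeakDerivOn U 0 0 := fun φ _ => by simp

namespace HasWeakDerivOn

theorem congr_ae (h : HasWeakDerivOn U u g) (huv : u =ᵐ[volume] v) (hgk : g =ᵐ[volume] k) :
    HasWeakDerivOn U v k := by
  intro φ hφ
  have hu : ∫ x, u x * deriv φ x = ∫ x, v x * deriv φ x := integral_congr_ae (huv.mul .rfl)
  have hg : ∫ x, g x * φ x = ∫ x, k x * φ x := integral_congr_ae (hgk.mul .rfl)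
  rw [← hu, ← hg, h φ hφ]

theorem add (h : HasWeakDerivOn U u g) (h' : HasWeakDerivOn U v k) (hu : LocallyIntegrable u)
    (hg : LocallyIntegrable g) (hv : LocallyIntegrable v) (hk : LocallyIntegrable k) :
    HasWeakDerivOn U (u + v) (g + k) := by
  intro φ hφ
  simp only [Pi.add_apply, add_mul]
  rw [integral_add (hφ.deriv.integrable_mul hu) (hφ.deriv.integrable_mul hv),
    integral_add (hφ.integrable_mul hg) (hφ.integrable_mul hk), h φ hφ, h' φ hφ, neg_add]

theorem sum {ι : Type*} {u g : ι → ℝ → ℂ} {s : Finset ι}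
    (h : ∀ i ∈ s, HasWeakDerivOn U (u i) (g i)) (hu : ∀ i ∈ s, LocallyIntegrable (u i))
    (hg : ∀ i ∈ s, LocallyIntegrable (g i)) :
    HasWeakDerivOn U (∑ i ∈ s, u i) (∑ i ∈ s, g i) := by
  intro φ hφ
  simp only [Finset.sum_apply, Finset.sum_mul]
  rw [integral_finsetSum _ fun i hi => hφ.deriv.integrable_mul (hu i hi),
    integral_finsetSum _ fun i hi => hφ.integrable_mul (hg i hi), ← Finset.sum_neg_distrib]
  exact Finset.sum_congr rfl fun i hi => h i hi φ hφ

end HasWeakDerivOn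

theorem IsTestFunction.nhds_cases (hφ : IsTestFunction U φ) (hS : Disjoint U (frontier S))
    (x : ℝ) : S ∈ 𝓝 x ∨ Sᶜ ∈ 𝓝 x ∨ φ =ᶠ[𝓝 x] 0 := by
  by_cases hx : x ∈ frontier S
  · exact .inr (.inr (notMem_tsupport_iff_eventuallyEq.1 fun h =>
      hS.notMem_of_mem_left (hφ.support_subset h) hx))
  · rw [← Set.mem_compl_iff, compl_frontier_eq_union_interior] at hx
    exact hx.imp mem_interior_iff_mem_nhds.1 fun h => .inl (mem_interior_iff_mem_nhds.1 h)

theorem IsTestFunction.indicator (hφ : IsTestFunction U φ) (hS : Disjoint U (frontier S)) :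
    IsTestFunction U (S.indicator φ) := by
  have hsupp : Function.support (S.indicator φ) ⊆ Function.support φ := by
    rw [Set.support_indicator]
    exact Set.inter_subset_right
  refine ⟨contDiff_iff_contDiffAt.2 fun x => ?_, hφ.compact_support.mono hsupp,
    (closure_mono hsupp).trans hφ.support_subset⟩
  rcases hφ.nhds_cases hS x with h | h | h
  · exact hφ.smooth.contDiffAt.congr_of_eventuallyEq
      (eventually_of_mem h fun y hy => Set.indicator_of_mem hy _)
  · exact contDiffAt_const.congr_of_eventuallyEq
      (eventually_of_mem h fun y hy => Set.indicator_of_notMem hy _)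
  · exact contDiffAt_const.congr_of_eventuallyEq
      (h.mono fun y hy => Set.indicator_apply_eq_zero.2 fun _ => hy)

theorem IsTestFunction.deriv_indicator (hφ : IsTestFunction U φ) (hS : Disjoint U (frontier S)) :
    _root_.deriv (S.indicator φ) = S.indicator (_root_.deriv φ) := by
  ext x
  rcases hφ.nhds_cases hS x with h | h | h
  · rw [Set.indicator_of_mem (mem_of_mem_nhds h)]
    exact EventuallyEq.deriv_eq (eventually_of_mem h fun y hy => Set.indicator_of_mem hy _)
  · rw [Set.indicator_of_notMem (mem_of_mem_nhds h)]
    exact (EventuallyEq.deriv_eq (f := fun _ => 0)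
      (eventually_of_mem h fun y hy => Set.indicator_of_notMem hy _)).trans (deriv_const x 0)
  · have h' : S.indicator φ =ᶠ[𝓝 x] fun _ => 0 :=
      h.mono fun y hy => Set.indicator_apply_eq_zero.2 fun _ => hy
    rw [h'.deriv_eq, deriv_const, Set.indicator_apply_eq_zero.2 fun _ => ?_]
    exact h.deriv_eq.trans (deriv_const x 0)

theorem HasWeakDerivOn.indicator (h : HasWeakDerivOn U u g) (hS : Disjoint U (frontier S)) :
    HasWeakDerivOn U (S.indicator u) (S.indicator g) := by
  intro φ hφ
  have swap : ∀ p q : ℝ → ℂ, ∀ x, S.indicator p x * q x = p x * S.indicator q x := fun p q x => by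
    by_cases hx : x ∈ S <;> simp [hx]
  simp only [swap, ← hφ.deriv_indicator hS]
  exact h _ (hφ.indicator hS)

/-- A distribution on an interval whose derivative vanishes is a constant; `T` is the distribution,
its linearity being needed only in the form `map_sub`. -/
theorem exists_eq_mul_integral_of_forall_deriv_eq_zero (hU : IsOpen U) (hU' : U.OrdConnected)
    {T : (ℝ → ℂ) → ℂ}
    (map_sub : ∀ φ ψ : ℝ → ℂ, IsTestFunction U φ → IsTestFunction U ψ → ∀ c : ℂ,
      T (fun x => φ x - c * ψ x) = T φ - c * T ψ)
    (hT : ∀ φ, IsTestFunction U φ → T (deriv φ) = 0) :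
    ∃ c, ∀ φ, IsTestFunction U φ → T φ = c * ∫ x, φ x := by
  rcases U.eq_empty_or_nonempty with rfl | hne
  · refine ⟨0, fun φ hφ => ?_⟩
    obtain rfl : φ = 0 := tsupport_eq_empty_iff.1 (Set.subset_empty_iff.1 hφ.support_subset)
    simpa using hT 0 hφ
  obtain ⟨η, hη, hη1⟩ := exists_isTestFunction_integral_eq_one hU hne
  refine ⟨T η, fun ψ hψ => ?_⟩
  obtain ⟨φ, hφ, hderiv⟩ := exists_isTestFunction_deriv_eq hU'
    (hψ.sub_const_mul hη (∫ x, ψ x)) <| by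
      rw [integral_sub hψ.integrable (hη.integrable.const_mul _), integral_const_mul, hη1]
      ring
  have h0 := hT φ hφ
  rw [hderiv, map_sub ψ η hψ hη] at h0
  linear_combination h0

theorem integral_mul_sub_const_mul (hw : LocallyIntegrable w) (hφ : IsTestFunction U φ)
    (hψ : IsTestFunction U ψ) (c : ℂ) :
    ∫ x, w x * (φ x - c * ψ x) = (∫ x, w x * φ x) - c * ∫ x, w x * ψ x := by
  rw [← integral_const_mul, ← integral_sub (hφ.integrable_mul hw)
    ((hψ.integrable_mul hw).const_mul c)]
  exact integral_congr_ae (ae_of_all _ fun x => by ring)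

theorem ae_eq_zero_of_forall_integral_mul_eq_zero (hU : IsOpen U) (hw : LocallyIntegrable w)
    (h : ∀ φ, IsTestFunction U φ → ∫ x, w x * φ x = 0) : ∀ᵐ x, x ∈ U → w x = 0 := by
  refine hU.ae_eq_zero_of_integral_contDiff_smul_eq_zero (hw.locallyIntegrableOn U)
    fun φ hφ hc hsupp => ?_
  rw [← h _ (isTestFunction_ofReal hφ hc hsupp)]
  exact integral_congr_ae (ae_of_all _ fun x => by simp [mul_comm])

theorem HasWeakDerivOn.ae_eq_on {X I : Set ℝ} (h : HasWeakDerivOn Xᶜ u g)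
    (h' : HasWeakDerivOn Xᶜ w k) (hX : X.Finite) (hg : LocallyIntegrable g)
    (hk : LocallyIntegrable k) (hI : IsOpen I) (huw : ∀ᵐ x, x ∈ I → u x = w x) :
    ∀ᵐ x, x ∈ I → g x = k x := by
  have hgk := ae_eq_zero_of_forall_integral_mul_eq_zero (hI.inter hX.isClosed.isOpen_compl)
    (hg.sub hk) fun φ hφ => by
      have hφX : IsTestFunction Xᶜ φ := hφ.mono Set.inter_subset_right
      have hint : ∫ x, u x * deriv φ x = ∫ x, w x * deriv φ x := by
        refine integral_congr_ae (huw.mono fun x hx => ?_)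
        by_cases hxI : x ∈ I
        · simp only [hx hxI]
        · simp only [image_eq_zero_of_notMem_tsupport (f := deriv φ) fun hc =>
            hxI (hφ.deriv.support_subset hc).1, mul_zero]
      simp only [Pi.sub_apply, sub_mul]
      rw [integral_sub (hφ.integrable_mul hg) (hφ.integrable_mul hk)]
      linear_combination h φ hφX - h' φ hφX - hint
  filter_upwards [hgk, hX.countable.ae_notMem volume] with x hx hxX hxI
  exact sub_eq_zero.1 (hx ⟨hxI, hxX⟩)

/-- The du Bois-Reymond lemma. -/
theorem HasWeakDerivOn.exists_ae_eq_primitive (h : HasWeakDerivOn U u g) (hU : IsOpen U)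
    (hU' : U.OrdConnected) (hu : LocallyIntegrable u) (hg : LocallyIntegrable g) :
    ∃ c, ∀ᵐ x, x ∈ U → u x = primitive c g x := by
  have hw := hu.sub ((continuous_primitive 0 hg).locallyIntegrable (μ := volume))
  obtain ⟨c, hc⟩ := exists_eq_mul_integral_of_forall_deriv_eq_zero hU hU'
    (T := fun φ => ∫ x, (u - primitive 0 g) x * φ x)
    (fun φ ψ hφ hψ c => integral_mul_sub_const_mul hw hφ hψ c) fun φ hφ => by
      simp only [Pi.sub_apply, sub_mul]
      rw [integral_sub (hφ.deriv.integrable_mul hu) (hφ.deriv.integrable_mul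
        (continuous_primitive 0 hg).locallyIntegrable), h φ hφ,
        hasWeakDerivOn_primitive U 0 hg φ hφ, sub_self]
  have hzero := ae_eq_zero_of_forall_integral_mul_eq_zero hU (hw.sub (locallyIntegrable_const c))
    fun φ hφ => by
      simp only [Pi.sub_apply (_ - _), sub_mul]
      rw [integral_sub (hφ.integrable_mul hw) (hφ.integrable.const_mul c), hc φ hφ,
        integral_const_mul, sub_self]
  refine ⟨c, ?_⟩
  filter_upwards [hzero] with x hx hxU
  rw [primitive_eq_const_add]
  exact sub_eq_iff_eq_add.1 (sub_eq_zero.1 (hx hxU))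

theorem exists_hasWeakDerivOn_primitive (hU : IsOpen U) (hU' : U.OrdConnected)
    (hu : LocallyIntegrable u) (hf : LocallyIntegrable f)
    (h : ∀ φ, IsTestFunction U φ → ∫ x, u x * deriv (deriv φ) x = ∫ x, f x * φ x) :
    ∃ c, HasWeakDerivOn U u (primitive c f) := by
  have hprim := (continuous_primitive 0 hf).locallyIntegrable (μ := volume)
  obtain ⟨c, hc⟩ := exists_eq_mul_integral_of_forall_deriv_eq_zero hU hU'
    (T := fun φ => (∫ x, u x * deriv φ x) + ∫ x, primitive 0 f x * φ x)
    (fun φ ψ hφ hψ c => by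
      have hderiv : deriv (fun x => φ x - c * ψ x) = fun x => deriv φ x - c * deriv ψ x :=
        funext fun x => ((hφ.differentiable x).hasDerivAt.sub
          ((hψ.differentiable x).hasDerivAt.const_mul c)).deriv
      rw [hderiv, integral_mul_sub_const_mul hu hφ.deriv hψ.deriv,
        integral_mul_sub_const_mul hprim hφ hψ]
      ring)
    fun φ hφ => by
      rw [h φ hφ, hasWeakDerivOn_primitive U 0 hf φ hφ, add_neg_cancel]
  refine ⟨-c, fun φ hφ => ?_⟩
  simp only [primitive_eq_const_add (-c) f, add_mul]
  rw [integral_add (hφ.integrable.const_mul _) (hφ.integrable_mul hprim), integral_const_mul]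
  linear_combination hc φ hφ

end WeakDerivative

section Gluing

variable {P : Type*} [AddCommGroup P] {Φ : P →+ ℝ → ℂ} {w : ℝ → ℂ}

theorem exists_ae_eq_sub_indicator_Ioi {I : Set ℝ} (hI : I.OrdConnected) {a : ℝ} {p q j : P}
    (hp : ∀ᵐ x, x ∈ I ∩ Set.Iio a → w x = Φ p x) (hq : ∀ᵐ x, x ∈ I ∩ Set.Ioi a → w x = Φ q x)
    (hj : a ∈ I → q - p = j) :
    ∃ r, ∀ᵐ x, x ∈ I → (w - (Set.Ioi a).indicator (Φ j)) x = Φ r x := by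
  by_cases ha : a ∈ I
  · refine ⟨p, ?_⟩
    filter_upwards [hp, hq, Measure.ae_ne volume a] with x hpx hqx hxa hxI
    rcases lt_or_gt_of_ne hxa with h | h
    · simp [hpx ⟨hxI, h⟩, h.le]
    · simp [hqx ⟨hxI, h⟩, h, ← hj ha]
  · rcases hI.isPreconnected.subset_or_subset isOpen_Iio isOpen_Ioi
      (Set.Iio_disjoint_Ioi_of_not_lt (lt_irrefl a))
      (by rwa [Set.Iio_union_Ioi, Set.subset_compl_singleton_iff]) with h | h
    · exact ⟨p, hp.mono fun x hx hxI => by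
        simp [hx ⟨hxI, h hxI⟩, (Set.mem_Iio.1 (h hxI)).le]⟩
    · exact ⟨q - j, hq.mono fun x hx hxI => by
        simp [hx ⟨hxI, h hxI⟩, Set.mem_Ioi.1 (h hxI)]⟩

theorem eq_of_ae_eq_of_nonempty_inter
    (unique : ∀ p I, IsOpen I → I.Nonempty → (∀ᵐ x, x ∈ I → Φ p x = 0) → p = 0) {p q : P}
    {I J : Set ℝ} (hI : IsOpen I) (hJ : IsOpen J) (hne : (I ∩ J).Nonempty)
    (hp : ∀ᵐ x, x ∈ I → w x = Φ p x) (hq : ∀ᵐ x, x ∈ J → w x = Φ q x) : p = q := by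
  refine sub_eq_zero.1 (unique _ _ (hI.inter hJ) hne ?_)
  filter_upwards [hp, hq] with x hpx hqx hx
  rw [map_sub, Pi.sub_apply, ← hpx hx.1, ← hqx hx.2, sub_self]

/-- The jump at each `a ∈ X` is the difference of the two members of `Φ` that agree with `w` on
either side of `a`; unique continuation makes it independent of the neighbourhood of `a`. -/
theorem exists_ae_eq_add_sum_indicator
    (unique : ∀ p I, IsOpen I → I.Nonempty → (∀ᵐ x, x ∈ I → Φ p x = 0) → p = 0) (X : Finset ℝ)
    (hw : ∀ I : Set ℝ, IsOpen I → I.OrdConnected → I ⊆ (↑X)ᶜ →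
      ∃ p, ∀ᵐ x, x ∈ I → w x = Φ p x) :
    ∃ (p : P) (j : ℝ → P), ∀ᵐ x, w x = Φ p x + ∑ a ∈ X, (Set.Ioi a).indicator (Φ (j a)) x := by
  induction X using Finset.induction_on generalizing w with
  | empty =>
    obtain ⟨p, hp⟩ := hw Set.univ isOpen_univ Set.ordConnected_univ (by simp)
    exact ⟨p, 0, by simpa using hp⟩
  | insert a X ha ih =>
    have hside : ∀ J : Set ℝ, IsOpen J → J.OrdConnected → a ∉ J → ∀ I ⊆ (↑X : Set ℝ)ᶜ,
        IsOpen I → I.OrdConnected → ∃ p, ∀ᵐ x, x ∈ I ∩ J → w x = Φ p x := by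
      intro J hJ hJ' haJ I hIX hI hI'
      refine hw _ (hI.inter hJ) (hI'.inter hJ') fun x hx => ?_
      simpa using ⟨fun h => haJ (h ▸ hx.2), hIX hx.1⟩
    have hleft := hside (Set.Iio a) isOpen_Iio Set.ordConnected_Iio (lt_irrefl a)
    have hright := hside (Set.Ioi a) isOpen_Ioi Set.ordConnected_Ioi (lt_irrefl a)
    obtain ⟨l, u, ⟨hla, hau⟩, hlu⟩ := mem_nhds_iff_exists_Ioo_subset.1
      (X.isClosed.isOpen_compl.mem_nhds (show a ∈ (↑X : Set ℝ)ᶜ from ha))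
    obtain ⟨p₀, hp₀⟩ := hleft _ hlu isOpen_Ioo Set.ordConnected_Ioo
    obtain ⟨q₀, hq₀⟩ := hright _ hlu isOpen_Ioo Set.ordConnected_Ioo
    obtain ⟨r, j, hr⟩ := ih (w := w - (Set.Ioi a).indicator (Φ (q₀ - p₀))) fun I hI hI' hIX => by
      obtain ⟨p, hp⟩ := hleft I hIX hI hI'
      obtain ⟨q, hq⟩ := hright I hIX hI hI'
      refine exists_ae_eq_sub_indicator_Ioi hI' hp hq fun haI => ?_
      have hnhds := (hI.inter isOpen_Ioo).mem_nhds ⟨haI, hla, hau⟩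
      rw [eq_of_ae_eq_of_nonempty_inter unique (hI.inter isOpen_Iio) (isOpen_Ioo.inter isOpen_Iio)
          ((nonempty_of_mem (inter_mem_nhdsWithin (Set.Iio a) hnhds)).mono
            fun x hx => ⟨⟨hx.2.1, hx.1⟩, hx.2.2, hx.1⟩) hp hp₀,
        eq_of_ae_eq_of_nonempty_inter unique (hI.inter isOpen_Ioi) (isOpen_Ioo.inter isOpen_Ioi)
          ((nonempty_of_mem (inter_mem_nhdsWithin (Set.Ioi a) hnhds)).mono
            fun x hx => ⟨⟨hx.2.1, hx.1⟩, hx.2.2, hx.1⟩) hq hq₀]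
    refine ⟨r, Function.update j a (q₀ - p₀), ?_⟩
    filter_upwards [hr] with x hx
    rw [Finset.sum_insert ha, Function.update_self, Finset.sum_congr rfl fun b hb => by
      rw [Function.update_of_ne (ne_of_mem_of_not_mem hb ha)], add_left_comm, ← hx]
    simp

end Gluing

section Jumps

theorem tendsto_indicator_Ioi_const_right (a b : ℝ) (c : ℂ) :
    Tendsto ((Set.Ioi b).indicator fun _ : ℝ => c) (𝓝[>] a) (𝓝 (if b ≤ a then c else 0)) := by
  refine tendsto_const_nhds.congr' ?_
  split_ifs with h
  · filter_upwards [self_mem_nhdsWithin] with x hx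
    exact (Set.indicator_of_mem (f := fun _ : ℝ => c) (h.trans_lt hx)).symm
  · filter_upwards [nhdsWithin_le_nhds (Iio_mem_nhds (not_le.1 h))] with x hx
    exact (Set.indicator_of_notMem (f := fun _ : ℝ => c) (not_lt.2 hx.le)).symm

theorem tendsto_indicator_Ioi_const_left (a b : ℝ) (c : ℂ) :
    Tendsto ((Set.Ioi b).indicator fun _ : ℝ => c) (𝓝[<] a) (𝓝 (if b < a then c else 0)) := by
  refine tendsto_const_nhds.congr' ?_
  split_ifs with h
  · filter_upwards [nhdsWithin_le_nhds (Ioi_mem_nhds h)] with x hx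
    exact (Set.indicator_of_mem (f := fun _ : ℝ => c) hx).symm
  · filter_upwards [self_mem_nhdsWithin] with x hx
    exact (Set.indicator_of_notMem (f := fun _ : ℝ => c)
      (not_lt.2 ((Set.mem_Iio.1 hx).le.trans (not_lt.1 h)))).symm

end Jumps

section Trace

variable {l : Filter ℝ} {u w U : ℝ → ℂ} {s : Set ℝ} {a : ℝ} {c : ℂ}

/-- The essential limit of `u` along `l`; along `𝓝[>] a` and `𝓝[<] a` these are the boundary values
`u(a + 0)` and `u(a - 0)`. It is a junk value unless the limit exists. -/
noncomputable def trace (l : Filter ℝ) (u : ℝ → ℂ) : ℂ := limUnder (l ⊓ ae volume) u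

theorem eventuallyEq_inf_ae (hs : s ∈ l) (h : ∀ᵐ x, x ∈ s → u x = w x) :
    u =ᶠ[l ⊓ ae volume] w := by
  filter_upwards [mem_inf_of_left hs, mem_inf_of_right h] with x hx hux using hux hx

theorem trace_congr (h : u =ᶠ[l ⊓ ae volume] w) : trace l u = trace l w := by
  rw [trace, trace, limUnder, limUnder, map_congr h]

theorem tendsto_inf_ae_of_ae_eq (hU : Tendsto U l (𝓝 c)) (hs : s ∈ l)
    (h : ∀ᵐ x, x ∈ s → u x = U x) : Tendsto u (l ⊓ ae volume) (𝓝 c) :=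
  (hU.mono_left inf_le_left).congr' (eventuallyEq_inf_ae hs h).symm

theorem trace_eq_of_tendsto [NeBot (l ⊓ ae (volume : Measure ℝ))]
    (h : Tendsto u (l ⊓ ae volume) (𝓝 c)) : trace l u = c :=
  h.limUnder_eq

theorem trace_eq_of_ae_eq [NeBot (l ⊓ ae (volume : Measure ℝ))] (hU : Tendsto U l (𝓝 c))
    (hs : s ∈ l) (h : ∀ᵐ x, x ∈ s → u x = U x) : trace l u = c :=
  trace_eq_of_tendsto (tendsto_inf_ae_of_ae_eq hU hs h)

theorem neBot_nhdsWithin_inf_ae (hs : IsOpen s) (ha : a ∈ closure s) :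
    NeBot (𝓝[s] a ⊓ ae (volume : Measure ℝ)) := by
  refine inf_neBot_iff.2 fun t ht t' ht' => ?_
  obtain ⟨V, hV, haV, hVt⟩ := mem_nhdsWithin.1 ht
  by_contra hne
  refine (hV.inter hs).measure_ne_zero volume (mem_closure_iff.1 ha V hV haV)
    (measure_mono_null (fun x hx hxt' => hne ⟨x, hVt hx, hxt'⟩) (mem_ae_iff.1 ht'))

instance neBot_nhdsGT_inf_ae (a : ℝ) : NeBot (𝓝[>] a ⊓ ae (volume : Measure ℝ)) :=
  neBot_nhdsWithin_inf_ae isOpen_Ioi (by simp)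

instance neBot_nhdsLT_inf_ae (a : ℝ) : NeBot (𝓝[<] a ⊓ ae (volume : Measure ℝ)) :=
  neBot_nhdsWithin_inf_ae isOpen_Iio (by simp)

end Trace

section PiecewisePrimitive

variable {X : Set ℝ} {u g w k f : ℝ → ℂ}

/-- `u` is locally absolutely continuous on the complement of `X`, with derivative `g`, up to a null
set. -/
def IsPrimitiveOff (X : Set ℝ) (u g : ℝ → ℂ) : Prop :=
  ∀ I : Set ℝ, IsOpen I → I.OrdConnected → I ⊆ Xᶜ → ∃ c, ∀ᵐ x, x ∈ I → u x = primitive c g x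

theorem HasWeakDerivOn.isPrimitiveOff (h : HasWeakDerivOn Xᶜ u g) (hu : LocallyIntegrable u)
    (hg : LocallyIntegrable g) : IsPrimitiveOff X u g := fun _ hI hI' hIX =>
  HasWeakDerivOn.exists_ae_eq_primitive (fun φ hφ => h φ (hφ.mono hIX)) hI hI' hu hg

theorem exists_primitive_eqOn {I : Set ℝ} (hI : I.OrdConnected) (hf : LocallyIntegrable f)
    (hg : LocallyIntegrable g) (h : ∀ᵐ x, x ∈ I → f x = g x) (c : ℂ) :
    ∃ d, Set.EqOn (primitive c f) (primitive d g) I := by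
  rcases I.eq_empty_or_nonempty with rfl | ⟨a, ha⟩
  · exact ⟨0, Set.eqOn_empty _ _⟩
  refine ⟨primitive c f a - primitive 0 g a, fun x hx => ?_⟩
  have hfg : ∫ t in a..x, f t = ∫ t in a..x, g t := intervalIntegral.integral_congr_ae <| by
    filter_upwards [h] with t ht htI using ht (hI.uIcc_subset ha hx (Set.uIoc_subset_uIcc htI))
  rw [← primitive_sub c hf, ← primitive_sub 0 hg] at hfg
  rw [primitive_eq_const_add _ g]
  linear_combination hfg

theorem eq_zero_of_integrable_of_tendsto_atTop {c : ℂ} (hu : Integrable u)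
    (h : Tendsto u atTop (𝓝 c)) : c = 0 :=
  IntegrableAtFilter.eq_zero_of_tendsto (hu.integrableAtFilter _) (fun s hs => by
    obtain ⟨b, hb⟩ := mem_atTop_sets.1 hs
    exact top_le_iff.1 (Real.volume_Ici.ge.trans (measure_mono hb))) h

theorem eq_zero_of_integrable_of_tendsto_atBot {c : ℂ} (hu : Integrable u)
    (h : Tendsto u atBot (𝓝 c)) : c = 0 :=
  IntegrableAtFilter.eq_zero_of_tendsto (hu.integrableAtFilter _) (fun s hs => by
    obtain ⟨b, hb⟩ := mem_atBot_sets.1 hs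
    exact top_le_iff.1 (Real.volume_Iic.ge.trans (measure_mono hb))) h

theorem conj_primitive (c : ℂ) (f : ℝ → ℂ) (x : ℝ) :
    conj (primitive c f x) = primitive (conj c) (fun t => conj (f t)) x := by
  rw [primitive, primitive, map_add, intervalIntegral.intervalIntegral_eq_integral_uIoc,
    intervalIntegral.intervalIntegral_eq_integral_uIoc, integral_conj, Complex.real_smul,
    Complex.real_smul, map_mul, Complex.conj_ofReal]

namespace IsPrimitiveOff

theorem star (h : IsPrimitiveOff X u g) :
    IsPrimitiveOff X (fun x => conj (u x)) fun x => conj (g x) := fun I hI hI' hIX => by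
  obtain ⟨c, hc⟩ := h I hI hI' hIX
  exact ⟨conj c, hc.mono fun x hx hxI => by
    simp only [hx hxI, conj_primitive]⟩

theorem sub (h : IsPrimitiveOff X u g) (h' : IsPrimitiveOff X w k) (hg : LocallyIntegrable g)
    (hk : LocallyIntegrable k) :
    IsPrimitiveOff X (fun x => u x - w x) fun x => g x - k x := fun I hI hI' hIX => by
  obtain ⟨c, hc⟩ := h I hI hI' hIX
  obtain ⟨d, hd⟩ := h' I hI hI' hIX
  refine ⟨c - d, ?_⟩
  filter_upwards [hc, hd] with x hcx hdx hxI
  rw [hcx hxI, hdx hxI, primitive, primitive, primitive, intervalIntegral.integral_sub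
    (intervalIntegrable_of_locallyIntegrable hg _ _)
    (intervalIntegrable_of_locallyIntegrable hk _ _)]
  ring

theorem mul (h : IsPrimitiveOff X u g) (h' : IsPrimitiveOff X w k) (hg : LocallyIntegrable g)
    (hk : LocallyIntegrable k) (huw : LocallyIntegrable fun x => u x * k x + w x * g x) :
    IsPrimitiveOff X (fun x => u x * w x) fun x => u x * k x + w x * g x :=
  fun I hI hI' hIX => by
  obtain ⟨c, hc⟩ := h I hI hI' hIX
  obtain ⟨d, hd⟩ := h' I hI hI' hIX
  obtain ⟨e, he⟩ := exists_primitive_eqOn hI'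
    ((locallyIntegrable_primitive_mul c hg hk).add (locallyIntegrable_primitive_mul d hk hg)) huw
    (by filter_upwards [hc, hd] with x hcx hdx hxI
        simp [hcx hxI, hdx hxI]) (c * d)
  refine ⟨e, ?_⟩
  filter_upwards [hc, hd] with x hcx hdx hxI
  rw [hcx hxI, hdx hxI, primitive_mul_primitive hg hk]
  exact he hxI

theorem tendsto_trace (h : IsPrimitiveOff X u g) (hX : X.Finite) (hg : LocallyIntegrable g)
    {s : Set ℝ} (hs : IsOpen s) (hs' : s.OrdConnected) {a : ℝ} (ha : a ∈ frontier s) :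
    Tendsto u (𝓝[s] a ⊓ ae volume) (𝓝 (trace (𝓝[s] a) u)) := by
  rw [hs.frontier_eq] at ha
  obtain ⟨b, c, hbc, hbcX⟩ := mem_nhds_iff_exists_Ioo_subset.1
    ((hX.sdiff (t := {a})).isClosed.isOpen_compl.mem_nhds (show a ∈ (X \ {a})ᶜ by simp))
  obtain ⟨d, hd⟩ := h (s ∩ Set.Ioo b c) (hs.inter isOpen_Ioo) (hs'.inter Set.ordConnected_Ioo)
    fun x hx hxX => hbcX hx.2 ⟨hxX, ne_of_mem_of_not_mem hx.1 ha.2⟩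
  have := neBot_nhdsWithin_inf_ae hs ha.1
  have hlim := tendsto_inf_ae_of_ae_eq (continuous_primitive d hg).continuousWithinAt
    (inter_mem_nhdsWithin s (Ioo_mem_nhds hbc.1 hbc.2)) hd
  rwa [trace_eq_of_tendsto hlim]

theorem trace_nhdsGT_eq_trace_nhdsLT (h : IsPrimitiveOff X u g) (hX : IsClosed X)
    (hg : LocallyIntegrable g) {a : ℝ} (ha : a ∉ X) : trace (𝓝[>] a) u = trace (𝓝[<] a) u := by
  obtain ⟨b, c, hbc, hbcX⟩ := mem_nhds_iff_exists_Ioo_subset.1 (hX.isOpen_compl.mem_nhds ha)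
  obtain ⟨d, hd⟩ := h _ isOpen_Ioo Set.ordConnected_Ioo hbcX
  have htrace : ∀ s : Set ℝ, NeBot (𝓝[s] a ⊓ ae (volume : Measure ℝ)) →
      trace (𝓝[s] a) u = primitive d g a := fun s _ =>
    trace_eq_of_ae_eq (continuous_primitive d hg).continuousWithinAt
      (mem_nhdsWithin_of_mem_nhds (Ioo_mem_nhds hbc.1 hbc.2)) hd
  rw [htrace _ inferInstance, htrace _ inferInstance]

theorem exists_ae_eq_primitive_add_sum_indicator {X : Finset ℝ} (h : IsPrimitiveOff X u g) :
    ∃ (c : ℂ) (j : ℝ → ℂ),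
      ∀ᵐ x, u x = primitive c g x + ∑ a ∈ X, (Set.Ioi a).indicator (fun _ => j a) x := by
  obtain ⟨c, j, hcj⟩ := exists_ae_eq_add_sum_indicator (w := fun x => u x - primitive 0 g x)
    (Φ := Pi.constAddMonoidHom ℝ ℂ) (fun c I hI hne hc => by
      by_contra hc0
      exact hI.measure_ne_zero volume hne
        (measure_mono_null (fun x hx => fun h => hc0 (h hx)) (mem_ae_iff.1 hc)))
    X fun I hI hI' hIX => by
      obtain ⟨c, hc⟩ := h I hI hI' hIX
      refine ⟨c, hc.mono fun x hx hxI => ?_⟩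
      rw [hx hxI, primitive_eq_const_add c, add_sub_cancel_right]
      rfl
  refine ⟨c, j, hcj.mono fun x hx => ?_⟩
  rw [primitive_eq_const_add c, add_right_comm]
  exact sub_eq_iff_eq_add.1 hx

/-- Integrability makes the limits of `u` at `±∞` vanish, so only the jumps contribute. -/
theorem integral_eq_sum_trace_sub_trace {X : Finset ℝ} (h : IsPrimitiveOff X u g)
    (hu : Integrable u) (hg : Integrable g) :
    ∫ x, g x = ∑ a ∈ X, (trace (𝓝[<] a) u - trace (𝓝[>] a) u) := by
  obtain ⟨c, j, hcj⟩ := h.exists_ae_eq_primitive_add_sum_indicator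
  have hint := (integrable_congr hcj).1 hu
  have htop : Tendsto (primitive c g) atTop (𝓝 (-∑ a ∈ X, j a)) := by
    have hlim := tendsto_primitive_atTop c hg
    have hzero := eq_zero_of_integrable_of_tendsto_atTop hint <| hlim.add <|
      tendsto_finsetSum X fun a _ => tendsto_const_nhds.congr' <|
        (eventually_gt_atTop a).mono fun x (hx : x ∈ Set.Ioi a) =>
          (Set.indicator_of_mem hx fun _ => j a).symm
    rwa [eq_neg_of_add_eq_zero_left hzero] at hlim
  have hbot : Tendsto (primitive c g) atBot (𝓝 0) := by
    have hlim := tendsto_primitive_atBot c hg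
    have hzero := eq_zero_of_integrable_of_tendsto_atBot hint <| hlim.add <|
      tendsto_finsetSum X fun a _ => tendsto_const_nhds.congr' <|
        (eventually_le_atBot a).mono fun x hx =>
          (Set.indicator_of_notMem (Set.notMem_Ioi.2 hx) fun _ => j a).symm
    rw [Finset.sum_const_zero, add_zero] at hzero
    rwa [hzero] at hlim
  have hjump : ∀ a ∈ X, trace (𝓝[<] a) u - trace (𝓝[>] a) u = -j a := fun a ha => by
    have hcont := continuous_primitive c hg.locallyIntegrable
    have hcj' := hcj.mono fun x hx (_ : x ∈ Set.univ) => hx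
    rw [trace_eq_of_ae_eq (hcont.continuousWithinAt.tendsto.add <|
        tendsto_finsetSum X fun b _ => tendsto_indicator_Ioi_const_left a b (j b)) univ_mem hcj',
      trace_eq_of_ae_eq (hcont.continuousWithinAt.tendsto.add <|
        tendsto_finsetSum X fun b _ => tendsto_indicator_Ioi_const_right a b (j b)) univ_mem hcj',
      add_sub_add_left_eq_sub, ← Finset.sum_sub_distrib, Finset.sum_eq_single_of_mem a ha]
    · simp
    · intro b _ hba
      simp [hba.le_iff_lt]
  rw [integral_eq_of_tendsto_primitive hg htop hbot, sub_zero, Finset.sum_congr rfl hjump,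
    Finset.sum_neg_distrib]

end IsPrimitiveOff

end PiecewisePrimitive

section Green

variable {X : Set ℝ} {u g f w k h : L2R}

theorem locallyIntegrable_L2 (u : L2R) : LocallyIntegrable u :=
  (Lp.memLp u).locallyIntegrable (by norm_num)

theorem inner_L2 {μ : Measure ℝ} (u v : Lp ℂ 2 μ) :
    inner ℂ u v = ∫ x, v x * conj (u x) ∂μ := by
  simp only [L2.inner_def, RCLike.inner_apply]

theorem integrable_mul_conj (u w : L2R) : Integrable fun x => u x * conj (w x) := by
  simpa only [RCLike.inner_apply] using L2.integrable_inner (𝕜 := ℂ) w u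

theorem locallyIntegrable_conj {f : ℝ → ℂ} (hf : LocallyIntegrable f) :
    LocallyIntegrable fun x => conj (f x) := fun x => by
  obtain ⟨s, hs, h⟩ := hf x
  exact ⟨s, hs, (Complex.conjLIE.integrable_comp_iff (φ := f)).2 h⟩

namespace IsWeakDeriv

theorem isPrimitiveOff (h : IsWeakDeriv X u g) : IsPrimitiveOff X u g :=
  HasWeakDerivOn.isPrimitiveOff h (locallyIntegrable_L2 u) (locallyIntegrable_L2 g)

theorem hasRightValue (h : IsWeakDeriv X u g) (hX : X.Finite) (a : ℝ) :
    HasRightValue u a (trace (𝓝[>] a) u) :=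
  h.isPrimitiveOff.tendsto_trace hX (locallyIntegrable_L2 g) isOpen_Ioi Set.ordConnected_Ioi
    (by simp)

theorem hasLeftValue (h : IsWeakDeriv X u g) (hX : X.Finite) (a : ℝ) :
    HasLeftValue u a (trace (𝓝[<] a) u) :=
  h.isPrimitiveOff.tendsto_trace hX (locallyIntegrable_L2 g) isOpen_Iio Set.ordConnected_Iio
    (by simp)

end IsWeakDeriv

/-- The boundary value along `l` of the Wronskian of `u` and the conjugate of `w`, where `g` and `k`
are the derivatives of `u` and `w`. -/
noncomputable def wronskian (l : Filter ℝ) (u g w k : ℝ → ℂ) : ℂ :=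
  trace l g * conj (trace l w) - trace l u * conj (trace l k)

theorem trace_wronskian {l : Filter ℝ} [NeBot (l ⊓ ae (volume : Measure ℝ))] {u g w k : ℝ → ℂ}
    (hu : Tendsto u (l ⊓ ae volume) (𝓝 (trace l u)))
    (hg : Tendsto g (l ⊓ ae volume) (𝓝 (trace l g)))
    (hw : Tendsto w (l ⊓ ae volume) (𝓝 (trace l w)))
    (hk : Tendsto k (l ⊓ ae volume) (𝓝 (trace l k))) :
    trace l (fun x => g x * conj (w x) - u x * conj (k x)) = wronskian l u g w k :=
  trace_eq_of_tendsto <| (hg.mul (hw.star)).sub (hu.mul hk.star)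

theorem IsW22.integral_eq_sum_wronskian_sub {X : Finset ℝ} (hu : IsW22 X u g f)
    (hw : IsW22 X w k h) :
    ∫ x, (f x * conj (w x) - u x * conj (h x)) =
      ∑ a ∈ X, (wronskian (𝓝[<] a) u g w k - wronskian (𝓝[>] a) u g w k) := by
  have hf := locallyIntegrable_L2 f
  have hg := locallyIntegrable_L2 g
  have hk := locallyIntegrable_conj (locallyIntegrable_L2 k)
  have hh := locallyIntegrable_conj (locallyIntegrable_L2 h)
  have hgw' : Integrable fun x => g x * conj (k x) + conj (w x) * f x := by
    simpa only [mul_comm (conj (w _))] using!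
      (integrable_mul_conj g k).add (integrable_mul_conj f w)
  have huk' : Integrable fun x => u x * conj (h x) + conj (k x) * g x := by
    simpa only [mul_comm (conj (k _))] using!
      (integrable_mul_conj u h).add (integrable_mul_conj g k)
  have hprim := (hu.weak_deriv_two.isPrimitiveOff.mul hw.weak_deriv.isPrimitiveOff.star hf hk
    hgw'.locallyIntegrable).sub (hu.weak_deriv.isPrimitiveOff.mul
      hw.weak_deriv_two.isPrimitiveOff.star hg hh huk'.locallyIntegrable)
    hgw'.locallyIntegrable huk'.locallyIntegrable
  have hsum := hprim.integral_eq_sum_trace_sub_trace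
    ((integrable_mul_conj g w).sub (integrable_mul_conj u k)) (hgw'.sub huk')
  refine (integral_congr_ae (ae_of_all _ fun x => ?_)).trans
    (hsum.trans (Finset.sum_congr rfl fun a _ => ?_))
  · ring
  · have hX := X.finite_toSet
    rw [trace_wronskian (hu.weak_deriv.hasLeftValue hX a) (hu.weak_deriv_two.hasLeftValue hX a)
        (hw.weak_deriv.hasLeftValue hX a) (hw.weak_deriv_two.hasLeftValue hX a),
      trace_wronskian (hu.weak_deriv.hasRightValue hX a) (hu.weak_deriv_two.hasRightValue hX a)
        (hw.weak_deriv.hasRightValue hX a) (hw.weak_deriv_two.hasRightValue hX a)]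

end Green

section Regularity

theorem frequently_nonpos_of_hasDerivAt_of_integrableAtFilter {N N' : ℝ → ℝ}
    (hN : ∀ x, HasDerivAt N (N' x) x) (hN0 : ∀ x, 0 ≤ N x)
    (hint : IntegrableAtFilter N atTop) : ∃ᶠ x in atTop, N' x ≤ 0 := by
  intro hpos
  obtain ⟨a, ha⟩ := eventually_atTop.1 (hpos.mono fun _ => lt_of_not_ge)
  have hmono : StrictMonoOn N (Set.Ici a) :=
    strictMonoOn_of_deriv_pos (convex_Ici a)
      (continuous_iff_continuousAt.2 fun x => (hN x).continuousAt).continuousOn fun x hx => by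
        rw [(hN x).deriv]
        exact ha x (interior_subset hx)
  have hlt : 0 < N (a + 1) :=
    (hN0 a).trans_lt (hmono Set.self_mem_Ici (by simp) (lt_add_one a))
  obtain ⟨s, hs, hsN⟩ := hint
  obtain ⟨b, hb⟩ := mem_atTop_sets.1 (inter_mem hs (Ici_mem_atTop (a + 1)))
  have hconst : IntegrableOn (fun _ => N (a + 1)) (Set.Ici b) :=
    (hsN.mono_set fun x hx => (hb x hx).1).mono' aestronglyMeasurable_const <|
      (ae_restrict_iff' measurableSet_Ici).2 <| ae_of_all _ fun x hx => by
        have hax : a + 1 ≤ x := (hb x hx).2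
        rw [Real.norm_of_nonneg hlt.le]
        exact hmono.monotoneOn (by simp) ((le_add_of_nonneg_right zero_le_one).trans hax) hax
  rw [integrableOn_const_iff, Real.volume_Ici] at hconst
  exact hconst.elim (fun h => hlt.ne' (enorm_eq_zero.1 h)) (lt_irrefl _)

variable {f g : ℝ → ℂ} {a : ℝ}

theorem hasDerivAt_normSq_primitive (c : ℂ) (hg : Continuous g) (x : ℝ) :
    HasDerivAt (fun y => ‖primitive c g y‖ ^ 2) (2 * (conj (primitive c g x) * g x).re) x := by
  convert (hasDerivAt_primitive c hg x).norm_sq using 1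
  rw [Complex.inner, mul_comm (conj _)]

theorem intervalIntegral_normSq_primitive (c d : ℂ) (hf : LocallyIntegrable f) (a b : ℝ) :
    ((∫ x in a..b, ‖primitive c f x‖ ^ 2 : ℝ) : ℂ) =
      conj (primitive d (primitive c f) b) * primitive c f b -
      conj (primitive d (primitive c f) a) * primitive c f a -
      ∫ x in a..b, conj (primitive d (primitive c f) x) * f x := by
  set g := primitive c f
  have hgc : Continuous g := continuous_primitive c hf
  have hgc' : Continuous fun x => conj (g x) := Complex.continuous_conj.comp hgc
  have hf' : LocallyIntegrable fun x => conj (primitive d g x) * f x := by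
    simp only [conj_primitive]
    exact locallyIntegrable_primitive_mul _ hgc'.locallyIntegrable hf
  have hgg : LocallyIntegrable fun x => g x * conj (g x) := (hgc.mul hgc').locallyIntegrable
  have hprod : ∀ x, conj (primitive d g x) * g x = primitive (conj d * c)
      (fun y => conj (primitive d g y) * f y + g y * conj (g y)) x := fun x => by
    simp only [conj_primitive]
    exact primitive_mul_primitive hgc'.locallyIntegrable hf _ _ x
  have hadd : LocallyIntegrable fun y => conj (primitive d g y) * f y + g y * conj (g y) :=
    hf'.add hgg
  rw [hprod, hprod, primitive_sub _ hadd, intervalIntegral.integral_add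
    (intervalIntegrable_of_locallyIntegrable hf' _ _)
    (intervalIntegrable_of_locallyIntegrable hgg _ _), add_sub_cancel_left,
    ← intervalIntegral.integral_ofReal]
  simp only [Complex.mul_conj, Complex.normSq_eq_norm_sq]

/-- The energy identity `∫ |u'|² = [ū u'] - ∫ ū u''` bounds `u'` along a sequence of end points with
`Re (ū u') ≤ 0`, which exists since `|u|²` is integrable. -/
theorem memLp_Ioi_primitive_of_memLp (c d : ℂ) (hf : LocallyIntegrable f)
    (hfa : MemLp f 2 (volume.restrict (Set.Ioi a)))
    (hu : MemLp (primitive d (primitive c f)) 2 (volume.restrict (Set.Ioi a))) :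
    MemLp (primitive c f) 2 (volume.restrict (Set.Ioi a)) := by
  set g := primitive c f
  set u := primitive d g
  have hgc : Continuous g := continuous_primitive c hf
  have hfreq : ∃ᶠ x in atTop, 2 * (conj (u x) * g x).re ≤ 0 :=
    frequently_nonpos_of_hasDerivAt_of_integrableAtFilter (hasDerivAt_normSq_primitive d hgc)
      (fun x => by positivity) ⟨_, Ioi_mem_atTop a, hu.integrable_norm_pow two_ne_zero⟩
  have huf : IntegrableOn (fun x => conj (u x) * f x) (Set.Ioi a) :=
    hu.star.integrable_mul hfa
  rw [memLp_two_iff_integrable_sq_norm hgc.aestronglyMeasurable]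
  have : NeBot (atTop ⊓ 𝓟 {x | 2 * (conj (u x) * g x).re ≤ 0 ∧ a ≤ x}) :=
    frequently_mem_iff_neBot.1 (hfreq.and_eventually (eventually_ge_atTop a))
  refine integrableOn_Ioi_of_intervalIntegral_norm_bounded
    ((∫ x in Set.Ioi a, ‖conj (u x) * f x‖) - (conj (u a) * g a).re) a
    (l := atTop ⊓ 𝓟 {x | 2 * (conj (u x) * g x).re ≤ 0 ∧ a ≤ x})
    (fun b => (hgc.norm.pow 2).integrableOn_Ioc) (tendsto_id.mono_left inf_le_left)
    (mem_inf_of_right fun b hb => ?_)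
  have henergy : ∫ x in a..b, ‖g x‖ ^ 2 = (conj (u b) * g b).re - (conj (u a) * g a).re -
      (∫ x in a..b, conj (u x) * f x).re :=
    congrArg Complex.re (intervalIntegral_normSq_primitive c d hf a b)
  have hbound : ‖∫ x in a..b, conj (u x) * f x‖ ≤ ∫ x in Set.Ioi a, ‖conj (u x) * f x‖ := by
    rw [intervalIntegral.integral_of_le hb.2]
    exact (norm_integral_le_integral_norm _).trans (setIntegral_mono_set huf.norm
      (ae_of_all _ fun x => norm_nonneg _) (Eventually.of_forall Set.Ioc_subset_Ioi_self))
  simp only [Set.mem_ofPred_eq, id, norm_pow, norm_norm]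
  have hre := (abs_le.1 (Complex.abs_re_le_norm (∫ x in a..b, conj (u x) * f x))).1
  have hneg : 2 * (conj (u b) * g b).re ≤ 0 := hb.1
  linarith

theorem primitive_comp_neg (c : ℂ) (f : ℝ → ℂ) :
    (fun x => primitive c f (-x)) = primitive c fun x => -f (-x) := by
  ext x
  rw [primitive, primitive, intervalIntegral.integral_neg, intervalIntegral.integral_comp_neg,
    neg_zero, intervalIntegral.integral_symm]

theorem neg_primitive (c : ℂ) (f : ℝ → ℂ) (x : ℝ) :
    -primitive c f x = primitive (-c) (fun t => -f t) x := by
  rw [primitive, primitive, neg_add, intervalIntegral.integral_neg]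

theorem memLp_Iio_iff_memLp_Ioi_comp_neg :
    MemLp f 2 (volume.restrict (Set.Iio a)) ↔
      MemLp (fun x => f (-x)) 2 (volume.restrict (Set.Ioi (-a))) := by
  have hpre : (Neg.neg ⁻¹' Set.Iio a : Set ℝ) = Set.Ioi (-a) := by simp
  have hmp := (Measure.measurePreserving_neg (volume : Measure ℝ)).restrict_preimage
    (measurableSet_Iio (a := a))
  rw [hpre] at hmp
  rw [← hmp.map_eq]
  exact (MeasurableEquiv.neg ℝ).memLp_map_measure_iff

theorem memLp_Iio_primitive_of_memLp (c d : ℂ) (hf : LocallyIntegrable f)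
    (hfa : MemLp f 2 (volume.restrict (Set.Iio a)))
    (hu : MemLp (primitive d (primitive c f)) 2 (volume.restrict (Set.Iio a))) :
    MemLp (primitive c f) 2 (volume.restrict (Set.Iio a)) := by
  have hfneg : LocallyIntegrable fun x => f (-x) := by
    rw [← Measure.map_neg_eq_self (volume : Measure ℝ)] at hf
    exact (locallyIntegrable_map_homeomorph (Homeomorph.neg ℝ)).1 hf
  have hneg : (fun x => -primitive c f (-x)) = primitive (-c) fun x => f (-x) := by
    ext x
    simpa only [neg_neg] using (congrArg Neg.neg (congrFun (primitive_comp_neg c f) x)).trans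
      (neg_primitive c _ x)
  rw [memLp_Iio_iff_memLp_Ioi_comp_neg] at hfa hu ⊢
  rw [primitive_comp_neg, hneg] at hu
  have hmem := memLp_Ioi_primitive_of_memLp (-c) d hfneg hfa hu
  rw [← hneg] at hmem
  simpa only [Pi.neg_def, neg_neg] using hmem.neg

end Regularity

section SecondOrder

variable {f u : ℝ → ℂ} {X : Finset ℝ}

/-- The affine function with value `p.1` at `0` and slope `p.2`, in the form in which it appears as
a solution of `u'' = 0`. -/
noncomputable def affinePrimitive : ℂ × ℂ →+ ℝ → ℂ where
  toFun p := primitive p.1 fun _ => p.2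
  map_zero' := by
    ext x
    simp [primitive]
  map_add' p q := by
    ext x
    simp only [primitive, Prod.fst_add, Prod.snd_add, Pi.add_apply,
      intervalIntegral.integral_const, smul_add]
    ring

theorem eq_zero_of_affinePrimitive_ae_eq_zero (p : ℂ × ℂ) (I : Set ℝ) (hI : IsOpen I)
    (hne : I.Nonempty) (h : ∀ᵐ x, x ∈ I → affinePrimitive p x = 0) : p = 0 := by
  obtain ⟨x, hx⟩ := hne
  have hderiv (y : ℝ) : HasDerivAt (affinePrimitive p) p.2 y :=
    hasDerivAt_primitive p.1 continuous_const y
  have heq : Set.EqOn (affinePrimitive p) 0 I :=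
    Measure.eqOn_open_of_ae_eq ((ae_restrict_iff' hI.measurableSet).2 h) hI
      (fun y _ => (hderiv y).continuousAt.continuousWithinAt) continuousOn_const
  have hslope : p.2 = 0 := (hderiv x).unique <|
    (hasDerivAt_const x (0 : ℂ)).congr_of_eventuallyEq (heq.eventuallyEq_of_mem (hI.mem_nhds hx))
  have hval : p.1 = 0 := by simpa [affinePrimitive, hslope, primitive] using heq hx
  exact Prod.ext hval hslope

theorem primitive_primitive_eq_affinePrimitive_add (hf : LocallyIntegrable f) (p : ℂ × ℂ)
    (x : ℝ) : primitive p.1 (primitive p.2 f) x =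
      affinePrimitive p x + primitive 0 (primitive 0 f) x := by
  have hint := (continuous_primitive 0 hf).intervalIntegrable (μ := volume) 0 x
  rw [funext (primitive_eq_const_add p.2 f), primitive, intervalIntegral.integral_add
    intervalIntegrable_const hint, ← add_assoc]
  exact congrArg (affinePrimitive p x + ·) (zero_add _).symm

theorem exists_ae_eq_primitive_primitive_add_sum_indicator (hu : LocallyIntegrable u)
    (hf : LocallyIntegrable f)
    (h : ∀ φ, IsTestFunction (↑X)ᶜ φ → ∫ x, u x * deriv (deriv φ) x = ∫ x, f x * φ x) :
    ∃ (p : ℂ × ℂ) (j : ℝ → ℂ × ℂ), u =ᵐ[volume] primitive p.1 (primitive p.2 f) +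
      ∑ a ∈ X, (Set.Ioi a).indicator (affinePrimitive (j a)) := by
  obtain ⟨p, j, hpj⟩ := exists_ae_eq_add_sum_indicator
    (w := fun x => u x - primitive 0 (primitive 0 f) x) eq_zero_of_affinePrimitive_ae_eq_zero X
    fun I hI hI' hIX => by
      obtain ⟨c, hc⟩ := exists_hasWeakDerivOn_primitive hI hI' hu hf fun φ hφ => h φ (hφ.mono hIX)
      obtain ⟨d, hd⟩ := hc.exists_ae_eq_primitive hI hI' hu
        (continuous_primitive c hf).locallyIntegrable
      exact ⟨(d, c), hd.mono fun x hx hxI => by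
        rw [hx hxI, primitive_primitive_eq_affinePrimitive_add hf (d, c), add_sub_cancel_right]⟩
  refine ⟨p, j, hpj.mono fun x hx => ?_⟩
  rw [Pi.add_apply, Finset.sum_apply, primitive_primitive_eq_affinePrimitive_add hf,
    add_right_comm]
  exact sub_eq_iff_eq_add.1 hx

theorem disjoint_compl_frontier_Ioi {a : ℝ} (ha : a ∈ X) :
    Disjoint (↑X : Set ℝ)ᶜ (frontier (Set.Ioi a)) := by
  rw [frontier_Ioi, Set.disjoint_singleton_right]
  exact fun h => h ha

theorem hasWeakDerivOn_primitive_add_sum_indicator (c : ℂ) (hf : LocallyIntegrable f)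
    (d : ℝ → ℂ) {k : ℝ → ℝ → ℂ} (hk : ∀ a, LocallyIntegrable (k a)) :
    HasWeakDerivOn (↑X)ᶜ
      (primitive c f + ∑ a ∈ X, (Set.Ioi a).indicator (primitive (d a) (k a)))
      (f + ∑ a ∈ X, (Set.Ioi a).indicator (k a)) := by
  have hprim (c : ℂ) {g : ℝ → ℂ} (hg : LocallyIntegrable g) :
      LocallyIntegrable (primitive c g) := (continuous_primitive c hg).locallyIntegrable
  have hind (a : ℝ) {g : ℝ → ℂ} (hg : LocallyIntegrable g) :
      LocallyIntegrable ((Set.Ioi a).indicator g) := hg.indicator measurableSet_Ioi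
  refine (hasWeakDerivOn_primitive _ c hf).add (HasWeakDerivOn.sum (fun a ha =>
    (hasWeakDerivOn_primitive _ (d a) (hk a)).indicator (disjoint_compl_frontier_Ioi ha))
    (fun a _ => hind a (hprim _ (hk a))) fun a _ => hind a (hk a)) (hprim c hf) hf ?_ ?_
  · exact locallyIntegrable_finsetSum' _ fun a _ => hind a (hprim _ (hk a))
  · exact locallyIntegrable_finsetSum' _ fun a _ => hind a (hk a)

theorem memLp_of_memLp_Iio_of_memLp_Ioi {a b : ℝ} (ha : MemLp f 2 (volume.restrict (Set.Iio a)))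
    (hab : MemLp f 2 (volume.restrict (Set.Icc a b)))
    (hb : MemLp f 2 (volume.restrict (Set.Ioi b))) : MemLp f 2 volume := by
  classical
  have hle : MemLp f 2 ((volume.restrict (Set.Ici a)).restrict (Set.Iic b)) := by
    rwa [Measure.restrict_restrict measurableSet_Iic, Set.inter_comm, Set.Ici_inter_Iic]
  have hgt : MemLp f 2 ((volume.restrict (Set.Ici a)).restrict (Set.Iic b)ᶜ) := by
    rw [Set.compl_Iic]
    exact hb.mono_measure (Measure.restrict_mono_measure Measure.restrict_le_self _)
  have hIci := hle.piecewise measurableSet_Iic hgt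
  rw [Set.piecewise_same, ← Set.compl_Iio] at hIci
  simpa only [Set.piecewise_same] using ha.piecewise measurableSet_Iio hIci

theorem memLp_primitive_add_sum_indicator {p : ℂ × ℂ} {j : ℝ → ℂ × ℂ} (hf : MemLp f 2 volume)
    (hu : MemLp (primitive p.1 (primitive p.2 f) +
      ∑ a ∈ X, (Set.Ioi a).indicator (affinePrimitive (j a))) 2 volume) :
    MemLp (primitive p.2 f + ∑ a ∈ X, (Set.Ioi a).indicator fun _ => (j a).2) 2 volume := by
  have hloc : LocallyIntegrable f := hf.locallyIntegrable (by norm_num)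
  obtain ⟨m, hm⟩ := X.bddBelow
  obtain ⟨M, hM⟩ := X.bddAbove
  have hleft (k : ℝ → ℝ → ℂ) {x : ℝ} (hx : x < m) :
      ∑ a ∈ X, (Set.Ioi a).indicator (k a) x = 0 :=
    Finset.sum_eq_zero fun a ha =>
      Set.indicator_of_notMem (Set.notMem_Ioi.2 (hx.le.trans (hm ha))) _
  have hright (k : ℝ → ℝ → ℂ) {x : ℝ} (hx : M < x) :
      ∑ a ∈ X, (Set.Ioi a).indicator (k a) x = ∑ a ∈ X, k a x :=
    Finset.sum_congr rfl fun a ha => Set.indicator_of_mem ((hM ha).trans_lt hx) _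
  refine memLp_of_memLp_Iio_of_memLp_Ioi (a := m) (b := M) ?_ ?_ ?_
  · refine (memLp_congr_ae ?_).1 (memLp_Iio_primitive_of_memLp p.2 p.1 hloc (hf.restrict _)
      ((memLp_congr_ae ?_).1 (hu.restrict _)))
    all_goals
      filter_upwards [ae_restrict_mem measurableSet_Iio] with x hx
      rw [Pi.add_apply, Finset.sum_apply, hleft _ hx, add_zero]
  · have hcont := continuous_primitive p.2 hloc
    exact ((memLp_two_iff_integrable_sq_norm hcont.aestronglyMeasurable).2
      (hcont.norm.pow 2).integrableOn_Icc).add <|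
        memLp_finsetSum' X fun a _ => (memLp_const _).indicator measurableSet_Ioi
  · set q := p + ∑ a ∈ X, j a
    refine (memLp_congr_ae ?_).1 (memLp_Ioi_primitive_of_memLp q.2 q.1 hloc (hf.restrict _)
      ((memLp_congr_ae ?_).1 (hu.restrict _)))
    · filter_upwards [ae_restrict_mem measurableSet_Ioi] with x hx
      rw [Pi.add_apply, Finset.sum_apply, hright _ hx, primitive_eq_const_add,
        primitive_eq_const_add p.2, Prod.snd_add, Prod.snd_sum]
      ring
    · filter_upwards [ae_restrict_mem measurableSet_Ioi] with x hx
      rw [Pi.add_apply, Finset.sum_apply, hright _ hx,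
        primitive_primitive_eq_affinePrimitive_add hloc,
        primitive_primitive_eq_affinePrimitive_add hloc, map_add, map_sum, Pi.add_apply,
        Finset.sum_apply]
      ring

/-- The domain of the maximal operator carries no condition on `u'` at infinity: on each half-line
outside the hull of `X`, `u'` is a primitive of `f`, hence square-integrable together with `f`. -/
theorem exists_isW22 (u f : L2R)
    (h : ∀ φ, IsTestFunction (↑X)ᶜ φ → ∫ x, u x * deriv (deriv φ) x = ∫ x, f x * φ x) :
    ∃ g, IsW22 X u g f := by
  have hf := locallyIntegrable_L2 f
  obtain ⟨p, j, hu⟩ :=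
    exists_ae_eq_primitive_primitive_add_sum_indicator (locallyIntegrable_L2 u) hf h
  have hg := memLp_primitive_add_sum_indicator (Lp.memLp f) ((memLp_congr_ae hu).1 (Lp.memLp u))
  have hug := hasWeakDerivOn_primitive_add_sum_indicator (X := X) p.1
    (continuous_primitive p.2 hf).locallyIntegrable (fun a => (j a).1)
    (k := fun a _ => (j a).2) fun a => locallyIntegrable_const _
  have hgf := hasWeakDerivOn_primitive_add_sum_indicator (X := X) p.2 hf (fun a => (j a).2)
    (k := fun _ => 0) fun _ => locallyIntegrable_zero
  refine ⟨hg.toLp, hug.congr_ae hu.symm hg.coeFn_toLp.symm, hgf.congr_ae ?_ ?_⟩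
  · refine .trans (.of_eq ?_) hg.coeFn_toLp.symm
    congr! with a _ x
    simp [primitive]
  · simp

end SecondOrder

section SelfAdjoint

open ContinuousLinearMap

variable {H K : Type*} [NormedAddCommGroup H] [InnerProductSpace ℂ H] [CompleteSpace H]
  [NormedAddCommGroup K] [InnerProductSpace ℂ K] [CompleteSpace K] {A : H →ₗ.[ℂ] H}

theorem mem_graph_iff_of_isSelfAdjoint (hA : IsSelfAdjoint A) {u v : H} :
    (u, v) ∈ A.graph ↔ ∀ p q, (p, q) ∈ A.graph → inner ℂ q u = inner ℂ p v := by
  have h := LinearPMap.adjoint_graph_eq_graph_adjoint hA.dense_domain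
  rw [LinearPMap.isSelfAdjoint_def.1 hA] at h
  conv_lhs => rw [h]
  simp only [Submodule.mem_adjoint_iff, sub_eq_zero]

theorem isSelfAdjoint_of_mem_graph_iff (hd : Dense (A.domain : Set H))
    (h : ∀ u v, (u, v) ∈ A.graph ↔ ∀ p q, (p, q) ∈ A.graph → inner ℂ q u = inner ℂ p v) :
    IsSelfAdjoint A := by
  refine LinearPMap.isSelfAdjoint_def.2 (LinearPMap.eq_of_eq_graph ?_)
  rw [LinearPMap.adjoint_graph_eq_graph_adjoint hd]
  ext ⟨u, v⟩
  rw [h]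
  simp only [Submodule.mem_adjoint_iff, sub_eq_zero]

theorem exists_mem_graph_iff_adjoint_mem_graph (A : H →ₗ.[ℂ] H) {R : H →L[ℂ] K}
    (hR : R ∘L adjoint R = .id ℂ K) :
    ∃ B : K →ₗ.[ℂ] K, ∀ p q, (p, q) ∈ B.graph ↔ (adjoint R p, adjoint R q) ∈ A.graph := by
  let G := A.graph.comap ((adjoint R).toLinearMap.prodMap (adjoint R).toLinearMap)
  have hfun : ∀ x ∈ G, x.1 = 0 → x.2 = 0 := fun x hx hx0 => by
    have h0 : adjoint R x.2 = 0 := A.graph_fst_eq_zero_snd hx (by simp [hx0])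
    rw [← ContinuousLinearMap.id_apply (R₁ := ℂ) x.2, ← hR, comp_apply, h0, map_zero]
  refine ⟨G.toLinearPMap, fun p q => ?_⟩
  rw [Submodule.toLinearPMap_graph_eq _ hfun]
  rfl

/-- The part of a self-adjoint operator in a reducing subspace, which is embedded by the isometry
`R†`, is self-adjoint. -/
theorem exists_isSelfAdjoint_mem_graph_iff (hA : IsSelfAdjoint A) {R : H →L[ℂ] K}
    (hR : R ∘L adjoint R = .id ℂ K)
    (h : ∀ u v, (u, v) ∈ A.graph → (adjoint R (R u), adjoint R (R v)) ∈ A.graph) :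
    ∃ B : K →ₗ.[ℂ] K, IsSelfAdjoint B ∧
      ∀ p q, (p, q) ∈ B.graph ↔ (adjoint R p, adjoint R q) ∈ A.graph := by
  obtain ⟨B, hB⟩ := exists_mem_graph_iff_adjoint_mem_graph A hR
  have hR' (p : K) : R (adjoint R p) = p := congr($hR p)
  refine ⟨B, isSelfAdjoint_of_mem_graph_iff ?_ fun p q => ?_, hB⟩
  · refine ((Function.RightInverse.surjective hR').denseRange.dense_image R.continuous
      hA.dense_domain).mono ?_
    rintro _ ⟨u, hu, rfl⟩
    obtain ⟨v, hv⟩ := LinearPMap.mem_domain_iff.1 hu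
    exact LinearPMap.mem_domain_of_mem_graph ((hB _ _).2 (h u v hv))
  · rw [hB, mem_graph_iff_of_isSelfAdjoint hA]
    simp only [adjoint_inner_right]
    refine ⟨fun hpq p' q' h' => ?_, fun hpq u v huv => hpq _ _ ((hB _ _).2 (h u v huv))⟩
    simpa only [hR'] using hpq _ _ ((hB p' q').1 h')

end SelfAdjoint

section Cut

variable {S : Set ℝ} {A : L2R →ₗ.[ℂ] L2R} {a : ℝ}

/-- Multiplication by the indicator function of `S`, encoded as restriction to `S` followed by
extension by zero. -/
noncomputable def cutL2 (S : Set ℝ) : L2R →L[ℂ] L2R :=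
  ContinuousLinearMap.adjoint (restrictL2 S) ∘L restrictL2 S

theorem coeFn_restrictL2 (S : Set ℝ) (u : L2R) : restrictL2 S u =ᵐ[volume.restrict S] u :=
  LpToLpRestrictCLM_coeFn ℂ S u

theorem restrictL2_surjective (hS : MeasurableSet S) : Function.Surjective (restrictL2 S) := by
  intro p
  have hp : MemLp (S.indicator p) 2 volume := (memLp_indicator_iff_restrict hS).2 (Lp.memLp p)
  refine ⟨hp.toLp, Lp.ext ((coeFn_restrictL2 S _).trans ?_)⟩
  filter_upwards [ae_restrict_of_ae hp.coeFn_toLp, ae_restrict_mem hS] with x hx hxS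
  rw [hx, Set.indicator_of_mem hxS]

theorem coeFn_cutL2 (hS : MeasurableSet S) (u : L2R) : cutL2 S u =ᵐ[volume] S.indicator u := by
  have hu : MemLp (S.indicator u) 2 volume := (Lp.memLp u).indicator hS
  suffices cutL2 S u = hu.toLp from this ▸ hu.coeFn_toLp
  refine ext_inner_left ℂ fun w => ?_
  have hw : (fun x => MemLp.toLp _ hu x * conj (w x)) =ᵐ[volume]
      S.indicator fun x => u x * conj (w x) :=
    hu.coeFn_toLp.mono fun x hx => by
      simp only [hx]
      by_cases hxS : x ∈ S <;> simp [hxS]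
  rw [cutL2, ContinuousLinearMap.comp_apply, ContinuousLinearMap.adjoint_inner_right, inner_L2,
    inner_L2, integral_congr_ae hw, integral_indicator hS]
  refine integral_congr_ae ?_
  filter_upwards [coeFn_restrictL2 S u, coeFn_restrictL2 S w] with x hxu hxw
  rw [hxu, hxw]

theorem restrictL2_cutL2 (hS : MeasurableSet S) (u : L2R) :
    restrictL2 S (cutL2 S u) = restrictL2 S u := by
  refine Lp.ext ((coeFn_restrictL2 S _).trans (.trans ?_ (coeFn_restrictL2 S u).symm))
  filter_upwards [ae_restrict_of_ae (coeFn_cutL2 hS u), ae_restrict_mem hS] with x hx hxS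
  rw [hx, Set.indicator_of_mem hxS]

theorem restrictL2_cutL2_of_disjoint {T : Set ℝ} (hS : MeasurableSet S) (hT : MeasurableSet T)
    (h : Disjoint S T) (u : L2R) : restrictL2 T (cutL2 S u) = 0 := by
  refine Lp.ext ((coeFn_restrictL2 T _).trans (.trans ?_ (Lp.coeFn_zero ℂ 2 _).symm))
  filter_upwards [ae_restrict_of_ae (coeFn_cutL2 hS u), ae_restrict_mem hT] with x hx hxT
  rw [hx, Set.indicator_of_notMem (h.notMem_of_mem_right hxT), Pi.zero_apply]

theorem restrictL2_comp_adjoint (hS : MeasurableSet S) :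
    restrictL2 S ∘L ContinuousLinearMap.adjoint (restrictL2 S) = .id ℂ _ := by
  ext1 p
  obtain ⟨u, rfl⟩ := restrictL2_surjective hS p
  exact restrictL2_cutL2 hS u

theorem cutL2_Iio_add_cutL2_Ioi (a : ℝ) (u : L2R) :
    cutL2 (Set.Iio a) u + cutL2 (Set.Ioi a) u = u := by
  refine Lp.ext ((Lp.coeFn_add _ _).trans ?_)
  filter_upwards [coeFn_cutL2 measurableSet_Iio u, coeFn_cutL2 measurableSet_Ioi u,
    Measure.ae_ne volume a] with x hl hr hx
  rw [Pi.add_apply, hl, hr]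
  rcases lt_or_gt_of_ne hx with h | h <;> simp [h, h.le]

theorem splitsAt_of_cutL2_mem_graph (hA : IsSelfAdjoint A)
    (h : ∀ u v, (u, v) ∈ A.graph → (cutL2 (Set.Iio a) u, cutL2 (Set.Iio a) v) ∈ A.graph) :
    SplitsAt A a := by
  have h' : ∀ u v, (u, v) ∈ A.graph →
      (cutL2 (Set.Ioi a) u, cutL2 (Set.Ioi a) v) ∈ A.graph := fun u v huv => by
    simpa only [Prod.mk_sub_mk, sub_eq_of_eq_add' (cutL2_Iio_add_cutL2_Ioi a _).symm] using
      A.graph.sub_mem huv (h u v huv)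
  obtain ⟨A₁, hA₁, h₁⟩ :=
    exists_isSelfAdjoint_mem_graph_iff hA (restrictL2_comp_adjoint measurableSet_Iio) h
  obtain ⟨A₂, hA₂, h₂⟩ :=
    exists_isSelfAdjoint_mem_graph_iff hA (restrictL2_comp_adjoint measurableSet_Ioi) h'
  refine ⟨A₁, A₂, hA₁, hA₂, fun u v => ?_⟩
  rw [h₁, h₂]
  refine ⟨fun huv => ⟨h u v huv, h' u v huv⟩, fun ⟨hl, hr⟩ => ?_⟩
  have hadd : (cutL2 (Set.Iio a) u, cutL2 (Set.Iio a) v) +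
      (cutL2 (Set.Ioi a) u, cutL2 (Set.Ioi a) v) ∈ A.graph := A.graph.add_mem hl hr
  rwa [Prod.mk_add_mk, cutL2_Iio_add_cutL2_Ioi, cutL2_Iio_add_cutL2_Ioi] at hadd

theorem SplitsAt.cutL2_mem_graph (h : SplitsAt A a) {u v : L2R} (huv : (u, v) ∈ A.graph) :
    (cutL2 (Set.Iio a) u, cutL2 (Set.Iio a) v) ∈ A.graph := by
  obtain ⟨A₁, A₂, -, -, hs⟩ := h
  have hd : Disjoint (Set.Iio a) (Set.Ioi a) := Set.Iio_disjoint_Ioi_of_not_lt (lt_irrefl a)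
  rw [hs, restrictL2_cutL2 measurableSet_Iio, restrictL2_cutL2 measurableSet_Iio,
    restrictL2_cutL2_of_disjoint measurableSet_Iio measurableSet_Ioi hd,
    restrictL2_cutL2_of_disjoint measurableSet_Iio measurableSet_Ioi hd]
  exact ⟨((hs u v).1 huv).1, A₂.graph.zero_mem⟩

end Cut

section Germ

variable {X I S : Set ℝ} {l : Filter ℝ} {u g w k w' k' : ℝ → ℂ} {a : ℝ}

theorem HasWeakDerivOn.eventuallyEq (h : HasWeakDerivOn Xᶜ u g) (h' : HasWeakDerivOn Xᶜ w k)
    (hX : X.Finite) (hg : LocallyIntegrable g) (hk : LocallyIntegrable k) (hI : IsOpen I)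
    (huw : u =ᶠ[𝓝[I] a ⊓ ae volume] w) : g =ᶠ[𝓝[I] a ⊓ ae volume] k := by
  obtain ⟨s, hs, t, ht, hst⟩ := mem_inf_iff_superset.1 huw
  obtain ⟨V, hV, haV, hVs⟩ := mem_nhdsWithin.1 hs
  exact eventuallyEq_inf_ae (inter_mem_nhdsWithin I (hV.mem_nhds haV)) <|
    h.ae_eq_on h' hX hg hk (hI.inter hV) <|
      eventually_of_mem ht fun x hx hxV => hst ⟨hVs hxV.symm, hx⟩

theorem tendsto_inf_ae_of_ae_eq_continuous (hw : Continuous w) (h : u =ᵐ[volume] w)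
    (a : ℝ) (I : Set ℝ) : Tendsto u (𝓝[I] a ⊓ ae volume) (𝓝 (w a)) :=
  tendsto_inf_ae_of_ae_eq hw.continuousWithinAt univ_mem (h.mono fun _ hx _ => hx)

theorem trace_eq_zero [NeBot (l ⊓ ae (volume : Measure ℝ))] (h : u =ᶠ[l ⊓ ae volume] 0) :
    trace l u = 0 :=
  trace_eq_of_tendsto (tendsto_const_nhds.congr' h.symm)

theorem wronskian_congr_right (hw : w =ᶠ[l ⊓ ae volume] w') (hk : k =ᶠ[l ⊓ ae volume] k') :
    wronskian l u g w k = wronskian l u g w' k' := by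
  rw [wronskian, wronskian, trace_congr hw, trace_congr hk]

theorem wronskian_eq_zero_right [NeBot (l ⊓ ae (volume : Measure ℝ))]
    (hw : w =ᶠ[l ⊓ ae volume] 0) (hk : k =ᶠ[l ⊓ ae volume] 0) : wronskian l u g w k = 0 := by
  rw [wronskian, trace_eq_zero hw, trace_eq_zero hk, map_zero, mul_zero, mul_zero, sub_zero]

theorem cutL2_eventuallyEq (hS : MeasurableSet S) (hl : S ∈ l) (u : L2R) :
    cutL2 S u =ᶠ[l ⊓ ae volume] u :=
  eventuallyEq_inf_ae hl <| (coeFn_cutL2 hS u).mono fun x hx hxS => by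
    rw [hx, Set.indicator_of_mem hxS]

theorem cutL2_eventuallyEq_zero (hS : MeasurableSet S) (hl : Sᶜ ∈ l) (u : L2R) :
    cutL2 S u =ᶠ[l ⊓ ae volume] 0 :=
  eventuallyEq_inf_ae hl <| (coeFn_cutL2 hS u).mono fun x hx hxS => by
    rw [hx, Set.indicator_of_notMem hxS, Pi.zero_apply]

end Germ

section Cutoff

variable {X U : Set ℝ} {φ χ : ℝ → ℂ}

theorem IsTestFunction.star (hφ : IsTestFunction U φ) : IsTestFunction U fun x => conj (φ x) :=
  ⟨Complex.conjCLE.contDiff.comp hφ.smooth,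
    hφ.compact_support.comp_left (g := fun z : ℂ => conj z) (map_zero _),
    (closure_mono (Function.support_comp_subset (map_zero (starRingEnd ℂ)) φ)).trans
      hφ.support_subset⟩

theorem deriv_conj (φ : ℝ → ℂ) : deriv (fun x => conj (φ x)) = fun x => conj (deriv φ x) :=
  funext fun _ => deriv.star

theorem IsCutoff.deriv_eq_zero (hχ : IsCutoff X χ) {a : ℝ} (ha : a ∈ X) : deriv χ a = 0 :=
  image_eq_zero_of_notMem_tsupport fun h => hχ.2.support_subset h ha

theorem exists_isCutoff (hX : X.Finite) (a : ℝ) :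
    ∃ χ : ℝ → ℂ, IsCutoff X χ ∧ χ =ᶠ[𝓝 a] 1 ∧ ∀ y ∈ X, y ≠ a → χ =ᶠ[𝓝 y] 0 := by
  obtain ⟨ε, hε, hball⟩ := Metric.nhds_basis_closedBall.mem_iff.1
    ((hX.sdiff (t := {a})).isClosed.isOpen_compl.mem_nhds (show a ∈ (X \ {a})ᶜ by simp))
  let b : ContDiffBump a := ⟨ε / 2, ε, half_pos hε, half_lt_self hε⟩
  have htest := isTestFunction_ofReal b.contDiff b.hasCompactSupport (Set.subset_univ _)
  have hone : (fun x => (b x : ℂ)) =ᶠ[𝓝 a] 1 := b.eventuallyEq_one.mono fun x hx => by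
    simp [hx]
  have hzero : ∀ y ∈ X, y ≠ a → (fun x => (b x : ℂ)) =ᶠ[𝓝 y] 0 := fun y hy hya => by
    have hyb : y ∉ tsupport b := by
      rw [b.tsupport_eq]
      exact fun h => hball h ⟨hy, hya⟩
    exact (notMem_tsupport_iff_eventuallyEq.1 hyb).mono fun x hx => by simp [hx]
  refine ⟨_, ⟨htest, htest.deriv.smooth, htest.deriv.compact_support, fun y hy hyX => ?_⟩,
    hone, hzero⟩
  refine notMem_tsupport_iff_eventuallyEq.2 ?_ hy
  rcases eq_or_ne y a with rfl | hya
  · exact hone.deriv.trans (.of_eq (funext fun _ => deriv_const _ 1))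
  · exact (hzero y hyX hya).deriv.trans (.of_eq (funext fun _ => deriv_const _ 0))

end Cutoff

section Domain

variable {X : Set ℝ} {A : L2R →ₗ.[ℂ] L2R} {u v g w k : L2R} {a β : ℝ}

/-- `u` lies in the domain of `A` and in `W₂²(ℝ ∖ X)`, with `u' = g` and `A u = -u''`. -/
def HasDomainDeriv (X : Set ℝ) (A : L2R →ₗ.[ℂ] L2R) (u g : L2R) : Prop :=
  ∃ v, (u, v) ∈ A.graph ∧ IsW22 X u g (-v)

theorem IsW22.inner_sub_inner_eq_sum {X : Finset ℝ} {p q : L2R} (hu : IsW22 X u g (-v))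
    (hp : IsW22 X p k (-q)) : inner ℂ q u - inner ℂ p v =
      ∑ a ∈ X, (wronskian (𝓝[<] a) u g p k - wronskian (𝓝[>] a) u g p k) := by
  rw [← hu.integral_eq_sum_wronskian_sub hp, inner_L2, inner_L2,
    ← integral_sub (integrable_mul_conj u q) (integrable_mul_conj v p)]
  refine integral_congr_ae ?_
  filter_upwards [Lp.coeFn_neg v, Lp.coeFn_neg q] with x hv hq
  rw [hv, hq, Pi.neg_apply, Pi.neg_apply, map_neg]
  ring

theorem DeltaPrimeCondition.wronskian_eq (hu : DeltaPrimeCondition β a u g)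
    (hw : DeltaPrimeCondition β a w k) :
    wronskian (𝓝[<] a) u g w k = wronskian (𝓝[>] a) u g w k := by
  obtain ⟨u₁, u₀, g₁, g₀, hu₁, hu₀, hg₁, hg₀, hg, hu⟩ := hu
  obtain ⟨w₁, w₀, k₁, k₀, hw₁, hw₀, hk₁, hk₀, hk, hw⟩ := hw
  have hw' := congrArg conj hw
  rw [sub_eq_zero.1 hk, add_self_div_two, map_sub, map_mul, Complex.conj_ofReal] at hw'
  rw [sub_eq_zero.1 hg, add_self_div_two] at hu
  rw [wronskian, wronskian, trace_eq_of_tendsto hu₁, trace_eq_of_tendsto hu₀,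
    trace_eq_of_tendsto hg₁, trace_eq_of_tendsto hg₀, trace_eq_of_tendsto hw₁,
    trace_eq_of_tendsto hw₀, trace_eq_of_tendsto hk₁, trace_eq_of_tendsto hk₀,
    sub_eq_zero.1 hg, sub_eq_zero.1 hk]
  linear_combination conj k₀ * hu - g₀ * hw'

theorem IsWeakDeriv.wronskian_congr {I : Set ℝ} {w' k' : ℝ → ℂ} (h : IsWeakDeriv X w k)
    (h' : HasWeakDerivOn Xᶜ w' k') (hX : X.Finite) (hk' : LocallyIntegrable k') (hI : IsOpen I)
    (hw : w =ᶠ[𝓝 a ⊓ ae volume] w') :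
    wronskian (𝓝[I] a) u g w k = wronskian (𝓝[I] a) u g w' k' :=
  have hw := hw.filter_mono (inf_le_inf_right _ nhdsWithin_le_nhds)
  wronskian_congr_right hw
    (HasWeakDerivOn.eventuallyEq h h' hX (locallyIntegrable_L2 k) hk' hI hw)

theorem IsWeakDeriv.cutL2 {S : Set ℝ} (h : IsWeakDeriv X u g) (hS : MeasurableSet S)
    (hSX : frontier S ⊆ X) : IsWeakDeriv X (cutL2 S u) (cutL2 S g) :=
  (HasWeakDerivOn.indicator h (Set.disjoint_compl_left_iff_subset.2 hSX)).congr_ae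
    (coeFn_cutL2 hS u).symm (coeFn_cutL2 hS g).symm

theorem IsTestFunction.isWeakDeriv_toLp {U : Set ℝ} {χ : ℝ → ℂ} (hχ : IsTestFunction U χ)
    (X : Set ℝ) : IsWeakDeriv X (hχ.memLp.toLp χ) (hχ.deriv.memLp.toLp (_root_.deriv χ)) :=
  (hχ.hasWeakDerivOn_deriv Xᶜ).congr_ae hχ.memLp.coeFn_toLp.symm
    hχ.deriv.memLp.coeFn_toLp.symm

end Domain

section Local

variable {X : Finset ℝ} {A : L2R →ₗ.[ℂ] L2R} {u v g w k : L2R} {a : ℝ}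

namespace IsLocalInteraction

theorem exists_isW22 (hA : IsLocalInteraction X A) (huv : (u, v) ∈ A.graph) :
    ∃ g, IsW22 X u g (-v) := by
  refine PointInteraction.exists_isW22 u (-v) fun φ hφ => ?_
  obtain ⟨p, q, hpq, hp, hq⟩ := hA.extends_minimal _ hφ.star
  have hsymm := (mem_graph_iff_of_isSelfAdjoint hA.selfAdjoint).1 huv p q hpq
  rw [inner_L2, inner_L2] at hsymm
  have hu : ∫ x, u x * conj (q x) = -∫ x, u x * deriv (deriv φ) x := by
    rw [← integral_neg]
    refine integral_congr_ae (hq.mono fun x hx => ?_)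
    simp only [hx, deriv_conj, map_neg, Complex.conj_conj, mul_neg]
  have hv : ∫ x, v x * conj (p x) = -∫ x, (-v) x * φ x := by
    rw [← integral_neg]
    refine integral_congr_ae ?_
    filter_upwards [hp, Lp.coeFn_neg v] with x hx hv
    rw [hx, hv, Pi.neg_apply, Complex.conj_conj, neg_mul, neg_neg]
  exact neg_injective (hu.symm.trans (hsymm.trans hv))

theorem exists_hasDomainDeriv (hA : IsLocalInteraction X A) {f : ℝ → ℂ} (hf : MemDomain A f) :
    ∃ u g, HasDomainDeriv X A u g ∧ u =ᵐ[volume] f := by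
  obtain ⟨u, hu, huf⟩ := hf
  obtain ⟨v, huv⟩ := LinearPMap.mem_domain_iff.1 hu
  obtain ⟨g, hg⟩ := hA.exists_isW22 huv
  exact ⟨u, g, ⟨v, huv, hg⟩, huf⟩

theorem exists_localization (hA : IsLocalInteraction X A) (hu : HasDomainDeriv X A u g)
    (a : ℝ) : ∃ w k, HasDomainDeriv X A w k ∧ w =ᶠ[𝓝 a ⊓ ae volume] u ∧
      ∀ y ∈ X, y ≠ a → w =ᶠ[𝓝 y ⊓ ae volume] 0 := by
  obtain ⟨χ, hχ, hone, hzero⟩ := exists_isCutoff X.finite_toSet a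
  obtain ⟨v, huv, -⟩ := hu
  obtain ⟨w, k, hw, hwχ⟩ := hA.exists_hasDomainDeriv
    (hA.isLocal u (LinearPMap.mem_domain_of_mem_graph huv) χ hχ)
  refine ⟨w, k, hw, ?_, fun y hy hya => ?_⟩
  · filter_upwards [mem_inf_of_left hone, mem_inf_of_right hwχ] with x hx hwx
    rw [hwx, hx, Pi.one_apply, one_mul]
  · filter_upwards [mem_inf_of_left (hzero y hy hya), mem_inf_of_right hwχ] with x hx hwx
    rw [hwx, hx, Pi.zero_apply, zero_mul]

theorem wronskian_eq (hA : IsLocalInteraction X A) (hu : HasDomainDeriv X A u g)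
    (hw : HasDomainDeriv X A w k) (ha : a ∈ X) :
    wronskian (𝓝[<] a) u g w k = wronskian (𝓝[>] a) u g w k := by
  have hX := X.finite_toSet
  obtain ⟨w', k', ⟨q', hpq', hw'⟩, hnear, hfar⟩ := hA.exists_localization hw a
  obtain ⟨v, huv, hu⟩ := hu
  obtain ⟨q, -, hw⟩ := hw
  have hsum := hu.inner_sub_inner_eq_sum hw'
  rw [(mem_graph_iff_of_isSelfAdjoint hA.selfAdjoint).1 huv w' q' hpq', sub_self,
    Finset.sum_eq_single_of_mem a ha fun y hy hya => ?_] at hsum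
  · have hk := locallyIntegrable_L2 k
    rw [← hw'.weak_deriv.wronskian_congr hw.weak_deriv hX hk isOpen_Iio hnear,
      ← hw'.weak_deriv.wronskian_congr hw.weak_deriv hX hk isOpen_Ioi hnear]
    exact sub_eq_zero.1 hsum.symm
  · have hzero := hasWeakDerivOn_zero (↑X : Set ℝ)ᶜ
    have hint : LocallyIntegrable (0 : ℝ → ℂ) := locallyIntegrable_zero
    rw [hw'.weak_deriv.wronskian_congr hzero hX hint isOpen_Iio (hfar y hy hya),
      hw'.weak_deriv.wronskian_congr hzero hX hint isOpen_Ioi (hfar y hy hya),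
      wronskian_eq_zero_right .rfl .rfl, wronskian_eq_zero_right .rfl .rfl, sub_self]

theorem mem_graph_of_wronskian_eq (hA : IsLocalInteraction X A) (hu : IsW22 X u g (-v))
    (h : ∀ w k, HasDomainDeriv X A w k → ∀ a ∈ X,
      wronskian (𝓝[<] a) w k u g = wronskian (𝓝[>] a) w k u g) : (u, v) ∈ A.graph := by
  refine (mem_graph_iff_of_isSelfAdjoint hA.selfAdjoint).2 fun w q hwq => ?_
  obtain ⟨k, hw⟩ := hA.exists_isW22 hwq
  have hsum := hw.inner_sub_inner_eq_sum hu
  rw [Finset.sum_eq_zero fun a ha => sub_eq_zero.2 (h w k ⟨q, hwq, hw⟩ a ha), sub_eq_zero] at hsum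
  rw [← inner_conj_symm, ← hsum, inner_conj_symm]

theorem trace_nhdsGT_deriv_eq (hA : IsLocalInteraction X A)
    (hcut : ∀ χ : ℝ → ℂ, IsCutoff X χ → MemDomain A χ) (hu : HasDomainDeriv X A u g)
    (ha : a ∈ X) : trace (𝓝[>] a) g = trace (𝓝[<] a) g := by
  obtain ⟨χ, hχ, hone, -⟩ := exists_isCutoff X.finite_toSet a
  obtain ⟨w, k, hw, hwχ⟩ := hA.exists_hasDomainDeriv (hcut χ hχ)
  have hwron := hA.wronskian_eq hu hw ha
  obtain ⟨q, -, hw⟩ := hw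
  have hcongr : ∀ s, IsOpen s → NeBot (𝓝[s] a ⊓ ae (volume : Measure ℝ)) →
      wronskian (𝓝[s] a) u g w k = trace (𝓝[s] a) g := fun s hs _ => by
    rw [hw.weak_deriv.wronskian_congr (hχ.1.hasWeakDerivOn_deriv _) X.finite_toSet
        hχ.1.deriv.continuous.locallyIntegrable hs (hwχ.filter_mono inf_le_right), wronskian,
      trace_eq_of_tendsto (tendsto_inf_ae_of_ae_eq_continuous hχ.1.continuous .rfl a s),
      trace_eq_of_tendsto (tendsto_inf_ae_of_ae_eq_continuous hχ.1.deriv.continuous .rfl a s),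
      hχ.deriv_eq_zero ha, hone.self_of_nhds, Pi.one_apply, map_one, map_zero, mul_one, mul_zero,
      sub_zero]
  rw [hcongr _ isOpen_Iio inferInstance, hcongr _ isOpen_Ioi inferInstance] at hwron
  exact hwron.symm

theorem splitsAt_of_trace_deriv_eq_zero (hA : IsLocalInteraction X A) (ha : a ∈ X)
    (h : ∀ u g, HasDomainDeriv X A u g → trace (𝓝[<] a) g = 0) : SplitsAt A a := by
  refine splitsAt_of_cutL2_mem_graph hA.selfAdjoint fun u v huv => ?_
  obtain ⟨g, hg⟩ := hA.exists_isW22 huv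
  have hu : HasDomainDeriv X A u g := ⟨v, huv, hg⟩
  have hfr : frontier (Set.Iio a) ⊆ ↑X := by
    rwa [frontier_Iio, Set.singleton_subset_iff]
  have hcut : IsW22 X (cutL2 (Set.Iio a) u) (cutL2 (Set.Iio a) g) (-cutL2 (Set.Iio a) v) := by
    rw [← map_neg]
    exact ⟨hg.weak_deriv.cutL2 measurableSet_Iio hfr,
      hg.weak_deriv_two.cutL2 measurableSet_Iio hfr⟩
  refine hA.mem_graph_of_wronskian_eq hcut fun w k hw y hy => ?_
  have hin : ∀ {l}, Set.Iio a ∈ l → wronskian l w k (cutL2 (Set.Iio a) u) (cutL2 (Set.Iio a) g) =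
      wronskian l w k u g := fun hl =>
    wronskian_congr_right (cutL2_eventuallyEq measurableSet_Iio hl u)
      (cutL2_eventuallyEq measurableSet_Iio hl g)
  have hout : ∀ {l} [NeBot (l ⊓ ae (volume : Measure ℝ))], Set.Ici a ∈ l →
      wronskian l w k (cutL2 (Set.Iio a) u) (cutL2 (Set.Iio a) g) = 0 := fun hl => by
    rw [← Set.compl_Iio] at hl
    exact wronskian_eq_zero_right (cutL2_eventuallyEq_zero measurableSet_Iio hl u)
      (cutL2_eventuallyEq_zero measurableSet_Iio hl g)
  rcases lt_trichotomy y a with hya | rfl | hya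
  · rw [hin (mem_nhdsWithin_of_mem_nhds (Iio_mem_nhds hya)),
      hin (mem_nhdsWithin_of_mem_nhds (Iio_mem_nhds hya)), hA.wronskian_eq hw hu hy]
  · rw [hin self_mem_nhdsWithin, hout (mem_of_superset self_mem_nhdsWithin Set.Ioi_subset_Ici_self),
      wronskian, h u g hu, h w k hw, map_zero, mul_zero, zero_mul, sub_zero]
  · rw [hout (mem_nhdsWithin_of_mem_nhds (Ici_mem_nhds hya)),
      hout (mem_nhdsWithin_of_mem_nhds (Ici_mem_nhds hya))]

end IsLocalInteraction

theorem exists_forall_eq_ofReal_mul {γ₀ d₀ : ℂ} (hγ₀ : γ₀ ≠ 0)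
    (h₀ : γ₀ * conj d₀ = d₀ * conj γ₀) :
    ∃ β : ℝ, ∀ γ d : ℂ, γ * conj d₀ = d * conj γ₀ → d = β * γ := by
  have hγ₀' : conj γ₀ ≠ 0 := (map_ne_zero _).2 hγ₀
  have hreal : conj (d₀ / γ₀) = d₀ / γ₀ := by
    rw [map_div₀, div_eq_div_iff hγ₀' hγ₀]
    linear_combination h₀
  refine ⟨(d₀ / γ₀).re, fun γ d h => ?_⟩
  rw [Complex.conj_eq_iff_re.1 hreal, ← hreal, map_div₀, div_mul_eq_mul_div, eq_div_iff hγ₀']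
  linear_combination -h

namespace IsLocalInteraction

theorem exists_deltaPrimeCondition (hA : IsLocalInteraction X A)
    (hcut : ∀ χ : ℝ → ℂ, IsCutoff X χ → MemDomain A χ) (ha : a ∈ X) (hs : ¬SplitsAt A a) :
    ∃ β : ℝ, ∀ u g, HasDomainDeriv X A u g → DeltaPrimeCondition β a u g := by
  obtain ⟨u₀, g₀, hu₀, hne⟩ : ∃ u g, HasDomainDeriv X A u g ∧ trace (𝓝[<] a) g ≠ 0 := by
    by_contra! h
    exact hs (hA.splitsAt_of_trace_deriv_eq_zero ha h)
  have hcont : ∀ {u g}, HasDomainDeriv X A u g → trace (𝓝[>] a) g = trace (𝓝[<] a) g :=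
    fun hu => hA.trace_nhdsGT_deriv_eq hcut hu ha
  have hpair : ∀ {u g}, HasDomainDeriv X A u g →
      trace (𝓝[<] a) g * conj (trace (𝓝[>] a) u₀ - trace (𝓝[<] a) u₀) =
        (trace (𝓝[>] a) u - trace (𝓝[<] a) u) * conj (trace (𝓝[<] a) g₀) := fun hu => by
    have hwron := hA.wronskian_eq hu hu₀ ha
    rw [wronskian, wronskian, hcont hu, hcont hu₀] at hwron
    rw [map_sub]
    linear_combination -hwron
  obtain ⟨β, hβ⟩ := exists_forall_eq_ofReal_mul hne (hpair hu₀)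
  refine ⟨β, fun u g hu => ?_⟩
  obtain ⟨v, -, hg⟩ := id hu
  have hX := X.finite_toSet
  refine ⟨_, _, _, _, hg.weak_deriv.hasRightValue hX a, hg.weak_deriv.hasLeftValue hX a,
    hg.weak_deriv_two.hasRightValue hX a, hg.weak_deriv_two.hasLeftValue hX a, ?_, ?_⟩
  · rw [hcont hu, sub_self]
  · rw [hcont hu, add_self_div_two, hβ _ _ (hpair hu)]

theorem isDeltaPrimeInteraction (hA : IsLocalInteraction X A)
    (hcut : ∀ χ : ℝ → ℂ, IsCutoff X χ → MemDomain A χ) (hs : ∀ a, ¬SplitsAt A a) :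
    IsDeltaPrimeInteraction X A := by
  have hβ : ∀ a, ∃ β : ℝ, a ∈ X → ∀ u g, HasDomainDeriv X A u g →
      DeltaPrimeCondition β a u g := fun a => by
    by_cases ha : a ∈ X
    · obtain ⟨β, h⟩ := hA.exists_deltaPrimeCondition hcut ha (hs a)
      exact ⟨β, fun _ => h⟩
    · exact ⟨0, fun h => absurd h ha⟩
  choose β hβ using hβ
  refine ⟨β, fun u v => ⟨fun huv => ?_, fun ⟨g, hg, hu⟩ => ?_⟩⟩
  · obtain ⟨g, hg⟩ := hA.exists_isW22 huv
    exact ⟨g, hg, fun a ha => hβ a ha u g ⟨v, huv, hg⟩⟩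
  · exact hA.mem_graph_of_wronskian_eq hg fun w k hw a ha =>
      (hβ a ha w k hw).wronskian_eq (hu a ha)

end IsLocalInteraction

end Local

section DeltaPrime

variable {X : Set ℝ} {A : L2R →ₗ.[ℂ] L2R}

namespace IsDeltaPrimeInteraction

theorem exists_mem_graph (h : IsDeltaPrimeInteraction X A) {χ : ℝ → ℂ} (hχ : IsCutoff X χ) :
    ∃ u v : L2R, (u, v) ∈ A.graph ∧ u =ᵐ[volume] χ := by
  obtain ⟨β, hβ⟩ := h
  have hχ₁ := hχ.1.deriv
  refine ⟨hχ.1.memLp.toLp χ, -hχ₁.deriv.memLp.toLp _, (hβ _ _).2 ⟨hχ₁.memLp.toLp _, ?_,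
    fun a ha => ?_⟩, hχ.1.memLp.coeFn_toLp⟩
  · rw [neg_neg]
    exact ⟨hχ.1.isWeakDeriv_toLp X, hχ₁.isWeakDeriv_toLp X⟩
  · have hu := tendsto_inf_ae_of_ae_eq_continuous hχ.1.continuous hχ.1.memLp.coeFn_toLp a
    have hg := tendsto_inf_ae_of_ae_eq_continuous hχ₁.continuous hχ₁.memLp.coeFn_toLp a
    exact ⟨_, _, _, _, hu _, hu _, hg _, hg _, sub_self _, by simp [hχ.deriv_eq_zero ha]⟩

theorem not_splitsAt (h : IsDeltaPrimeInteraction X A) (hX : X.Finite) (a : ℝ) :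
    ¬SplitsAt A a := by
  intro hs
  obtain ⟨χ, hχ, hone, -⟩ := exists_isCutoff hX a
  obtain ⟨u, v, huv, hu⟩ := h.exists_mem_graph hχ
  obtain ⟨β, hβ⟩ := h
  obtain ⟨g, hg, hcond⟩ := (hβ _ _).1 (hs.cutL2_mem_graph huv)
  have hzero : cutL2 (Set.Iio a) u =ᶠ[𝓝[>] a ⊓ ae volume] 0 :=
    cutL2_eventuallyEq_zero measurableSet_Iio
      (mem_of_superset self_mem_nhdsWithin fun x hx => Set.notMem_Iio.2 (Set.mem_Ioi.1 hx).le) u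
  have hleft : trace (𝓝[<] a) (cutL2 (Set.Iio a) u) = 1 := by
    rw [trace_congr (cutL2_eventuallyEq measurableSet_Iio self_mem_nhdsWithin u),
      trace_eq_of_tendsto (tendsto_inf_ae_of_ae_eq_continuous hχ.1.continuous hu a _),
      hone.self_of_nhds, Pi.one_apply]
  by_cases ha : a ∈ X
  · have hgzero : g =ᶠ[𝓝[>] a ⊓ ae volume] 0 :=
      HasWeakDerivOn.eventuallyEq hg.weak_deriv (hasWeakDerivOn_zero _) hX
        (locallyIntegrable_L2 g) locallyIntegrable_zero isOpen_Ioi hzero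
    obtain ⟨u₁, u₀, g₁, g₀, hu₁, hu₀, hg₁, -, hgg, huu⟩ := hcond a ha
    rw [← sub_eq_zero.1 hgg, ← trace_eq_of_tendsto hu₁, ← trace_eq_of_tendsto hu₀,
      ← trace_eq_of_tendsto hg₁, hleft, trace_eq_zero hzero, trace_eq_zero hgzero] at huu
    norm_num at huu
  · have hcont := hg.weak_deriv.isPrimitiveOff.trace_nhdsGT_eq_trace_nhdsLT hX.isClosed
      (locallyIntegrable_L2 g) ha
    rw [hleft, trace_eq_zero hzero] at hcont
    exact zero_ne_one hcont

end IsDeltaPrimeInteraction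

end DeltaPrime

end PointInteraction

theorem proposition1 (X : Set ℝ) (hX : X.Finite)
    (A : PointInteraction.L2R →ₗ.[ℂ] PointInteraction.L2R)
    (hA : PointInteraction.IsLocalInteraction X A) :
    PointInteraction.IsDeltaPrimeInteraction X A ↔
      (∀ χ : ℝ → ℂ, PointInteraction.IsCutoff X χ → PointInteraction.MemDomain A χ) ∧
      (∀ a : ℝ, ¬ PointInteraction.SplitsAt A a) := by
  refine ⟨fun h => ⟨fun χ hχ => ?_, h.not_splitsAt hX⟩, fun h => ?_⟩
  · obtain ⟨u, v, huv, hu⟩ := h.exists_mem_graph hχ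
    exact ⟨u, LinearPMap.mem_domain_of_mem_graph huv, hu⟩
  · lift X to Finset ℝ using hX
    exact hA.isDeltaPrimeInteraction h.1 h.2
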